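/- **Setting.** Let $\mathcal X\subset\mathbb R^{d}$ be compact and let $\mathcal H_k$ be a reproducing kernel Hilbert space (RKHS) of real functions on $\mathcal X$ whose kernel $k$ is measurable and satisfies $k(x,x)\le 1$. Let $f\in\mathcal H_k$ be an unknown utility with $\|f\|_k\le B$, and let $x^\star\in\mathcal X$ be a maximizer of $f$. Let $s(a)=(1+e^{-a})^{-1}$ and $\dot s=s(1-s)$. In round $t=1,2,\dots$ a pair $(x_t,x_t')\in\mathcal X^2$ is chosen on the basis of the past (and possibly additional randomness), and a feedback $y_t\in\{0,1\}$ is observed which, conditionally on the past and on $(x_t,x'_t)$, equals $1$ with probability $s(f(x_t)-f(x_t'))$. The dueling regret is $$R^{\mathrm D}(T)=\sum_{t=1}^T\tfrac12\bigl(s(f(x^\star)-f(x_t))+s(f(x^\star)-f(x'_t))-1\bigr).$$ **Confidence widths.** Let $k^{\mathrm D}((x_1,x_1'),(x_2,x_2'))=k(x_1,x_2)+k(x_1',x_2')-k(x_1,x_2')-k(x_1',x_2)$ be the dueling kernel on $\mathcal X\times\mathcal X$ and $\mathcal H_{k^{\mathrm D}}$ its RKHS. Let $\lambda>0$, $\delta\in(0,1]$,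 $\kappa=\sup_{|a|\le 2B}1/\dot s(a)$ and $L=\sup_{|a|\le 2B}\dot s(a)$. With $z_i=(x_i,x_i')$, $K_t=[k^{\mathrm D}(z_i,z_j)]_{i,j\le t}$ and $\mathbf k_t(z)=(k^{\mathrm D}(z_i,z))_{i\le t}$, set $$\sigma^{\mathrm D}_t(z)^2=k^{\mathrm D}(z,z)-\mathbf k_t(z)^\top(K_t+\lambda\kappa I)^{-1}\mathbf k_t(z),\qquad \gamma^{\mathrm D}_t=\sup_{z_1,\dots,z_t\in\mathcal X^2}\tfrac12\log\det\bigl(I+(\lambda\kappa)^{-1}K_t\bigr),$$ $$\beta^{\mathrm D}_t(\delta)=4LB+2L\sqrt{\tfrac{2\kappa}{\lambda}\bigl(\gamma_t^{\mathrm D}+\log\tfrac1\delta\bigr)} .$$ **Estimator.** Let $\hat h_t$ be the minimizer over $h\in\mathcal H_{k^{\mathrm D}}$ of $$\sum_{i\le t}\bigl(-y_i\log s(h(z_i))-(1-y_i)\log(1-s(h(z_i)))\bigr)+\tfrac\lambda2\|h\|^2,$$ and let $h_t$ be any projection of $\hat h_t$ to the $B$-ball, that is, any element of $\arg\min_{\|h\|\le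 B}\|g_t(h)-g_t(\hat h_t)\|_{V_t^{-1}}$, where $\varphi(z)=k^{\mathrm D}(z,\cdot)$, $g_t(h)=\sum_{i\le t}s(h(z_i))\varphi(z_i)+\lambda h$, $V_t=\sum_{i\le t}\varphi(z_i)\varphi(z_i)^\top+\lambda\kappa I$ and $\|v\|_{V_t^{-1}}^2=\langle v,V_t^{-1}v\rangle$ (so $h_t=\hat h_t$ when $\|\hat h_t\|\le B$). **Algorithm (kernelized MaxInP).** In round $t+1$ ($t\ge0$), with the data of the first $t$ rounds, form the set of plausible maximizers $$\mathcal M_{t+1}=\bigl\{x\in\mathcal X:\ s(h_t(x,x'))+\beta^{\mathrm D}_t(\delta)\,\sigma^{\mathrm D}_t(x,x')\ge\tfrac12\ \text{ for all }x'\in\mathcal X\bigr\},$$ and play a pair $(x_{t+1},x_{t+1}')\in\arg\max_{x,x'\in\mathcal M_{t+1}}\sigma^{\mathrm D}_t(x,x')$. **Theorem.** With probability at least $1-\delta$, the following holds simultaneously for all $T\ge0$: $$R^{\mathrm D}(T)\le \frac{3\sqrt2}{\sqrt{\log(1+4(\lambda\kappa)^{-1})}}\;\beta^{\mathrm D}_T(\delta)\sqrt{T\gamma^{\mathrm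 D}_T},$$ and, if moreover $\|\hat h_t\|\le B$ for all $0\le t<T$ (so that no projection takes place), then $$R^{\mathrm D}(T)\le C_2\,\beta^{\mathrm D}_T(\delta)\sqrt{T\gamma^{\mathrm D}_T},\qquad C_2=\frac{4}{\sqrt{\log(1+4(\lambda\kappa)^{-1})}} .$$ -/

import Mathlib

open MeasureTheory ProbabilityTheory
open scoped Matrix

noncomputable section

namespace DuelingBandit

/-! ### The sigmoid link -/

/-- The derivative `s(a) (1 - s(a))` of the sigmoid `s`. -/
def sigmoidSlope (a : ℝ) : ℝ := Real.sigmoid a * (1 - Real.sigmoid a)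

/-- `κ = sup_{|a| ≤ r} 1 / s'(a)`. -/
def kappa (r : ℝ) : ℝ := sSup ((fun a => 1 / sigmoidSlope a) '' Set.Icc (-r) r)

/-- `L = sup_{|a| ≤ r} s'(a)`. -/
def slopeSup (r : ℝ) : ℝ := sSup (sigmoidSlope '' Set.Icc (-r) r)

/-! ### Kernels -/

/-- The real-valued reproducing kernel `k(x, y)` of a reproducing kernel Hilbert space of
real-valued functions. -/
def kern {A : Type*} (H : Type*) [NormedAddCommGroup H] [InnerProductSpace ℝ H] [CompleteSpace H]
    [RKHS ℝ H A ℝ] (x y : A) : ℝ := RKHS.kernel H x y (1 : ℝ)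

/-- The canonical feature `φ(x) = k(x, ·)`, as an element of the reproducing kernel
Hilbert space. -/
def feature {A : Type*} (H : Type*) [NormedAddCommGroup H] [InnerProductSpace ℝ H]
    [CompleteSpace H] [RKHS ℝ H A ℝ] (x : A) : H := RKHS.kerFun H x (1 : ℝ)

/-- The dueling kernel
`k^D((x₁,x₁'),(x₂,x₂')) = k(x₁,x₂) + k(x₁',x₂') - k(x₁,x₂') - k(x₁',x₂)`. -/
def duelingKernel {A : Type*} (k : A → A → ℝ) (z w : A × A) : ℝ :=
  k z.1 w.1 + k z.2 w.2 - k z.1 w.2 - k z.2 w.1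

section Kernel

variable {Z : Type*}

/-- The kernel matrix `[K_t]_{ij} = k(z_i, z_j)`. -/
def kernelMatrix (k : Z → Z → ℝ) {t : ℕ} (z : Fin t → Z) : Matrix (Fin t) (Fin t) ℝ :=
  Matrix.of fun i j => k (z i) (z j)

/-- The vector `k_t(w) = (k(z_1, w), …, k(z_t, w))`. -/
def kernelVec (k : Z → Z → ℝ) {t : ℕ} (z : Fin t → Z) (w : Z) : Fin t → ℝ := fun i => k (z i) w

/-- `σ_t(w)`, where `σ_t²(w) = k(w,w) - k_t(w)ᵀ (K_t + c I)⁻¹ k_t(w)`. -/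
def sigma (k : Z → Z → ℝ) (c : ℝ) {t : ℕ} (z : Fin t → Z) (w : Z) : ℝ :=
  √(k w w - kernelVec k z w ⬝ᵥ
    ((kernelMatrix k z + c • (1 : Matrix (Fin t) (Fin t) ℝ))⁻¹ *ᵥ kernelVec k z w))

/-- The information gain `γ_t = sup_{z_1,…,z_t} ½ log det(I + c⁻¹ K_t)`. -/
def infoGain (k : Z → Z → ℝ) (c : ℝ) (t : ℕ) : ℝ :=
  ⨆ z : Fin t → Z, 1 / 2 * Real.log ((1 : Matrix (Fin t) (Fin t) ℝ) + c⁻¹ • kernelMatrix k z).det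

/-- `β_t(δ) = 4 L B + 2 L √((2κ/λ) (γ_t + log(1/δ)))`, for functions in the `B`-ball whose values
lie in `[-r, r]`. -/
def beta (k : Z → Z → ℝ) (lam B r δ : ℝ) (t : ℕ) : ℝ :=
  4 * slopeSup r * B + 2 * slopeSup r *
    √(2 * kappa r / lam * (infoGain k (lam * kappa r) t + Real.log (1 / δ)))

end Kernel

/-! ### The regularised logistic estimator and its projection -/

section Estimator

variable {Z : Type*} {H : Type*} [NormedAddCommGroup H] [InnerProductSpace ℝ H]
  [CompleteSpace H] [RKHS ℝ H Z ℝ]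

/-- The regularised negative log-likelihood of the data `(z_i, y_i)`, `i < t`, at `h`. -/
def logisticLoss (lam : ℝ) {t : ℕ} (z : Fin t → Z) (y : Fin t → ℝ) (h : H) : ℝ :=
  (∑ i, (-(y i) * Real.log (Real.sigmoid (h (z i)))
      - (1 - y i) * Real.log (1 - Real.sigmoid (h (z i))))) + lam / 2 * ‖h‖ ^ 2

/-- `h` minimises the regularised negative log-likelihood over the whole space. -/
def IsLogisticMinimizer (lam : ℝ) {t : ℕ} (z : Fin t → Z) (y : Fin t → ℝ) (h : H) : Prop :=
  ∀ h' : H, logisticLoss lam z y h ≤ logisticLoss lam z y h'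

/-- `g_t(h) = ∑_i s(h(z_i)) φ(z_i) + λ h`. -/
def gradMap (lam : ℝ) {t : ℕ} (z : Fin t → Z) (h : H) : H :=
  (∑ i, Real.sigmoid (h (z i)) • feature H (z i)) + lam • h

variable (H) in
/-- The operator `V_t = ∑_i φ(z_i) φ(z_i)ᵀ + c I`. -/
def covOp (c : ℝ) {t : ℕ} (z : Fin t → Z) : H →L[ℝ] H :=
  (∑ i, InnerProductSpace.rankOne ℝ (feature H (z i)) (feature H (z i)))
    + c • ContinuousLinearMap.id ℝ H

/-- `‖v‖_{V_t⁻¹} = ⟨v, V_t⁻¹ v⟩^{1/2}`. -/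
def invCovNorm (c : ℝ) {t : ℕ} (z : Fin t → Z) (v : H) : ℝ :=
  √(inner ℝ v ((covOp H c z).inverse v))

/-- `h` is a projection of `hhat` to the ball of radius `B`, in the gradient metric:
`h ∈ argmin_{‖h'‖ ≤ B} ‖g_t(h') - g_t(hhat)‖_{V_t⁻¹}`. -/
def IsProjection (lam c B : ℝ) {t : ℕ} (z : Fin t → Z) (hhat h : H) : Prop :=
  ‖h‖ ≤ B ∧ ∀ h' : H, ‖h'‖ ≤ B →
    invCovNorm c z (gradMap lam z h - gradMap lam z hhat)
      ≤ invCovNorm c z (gradMap lam z h' - gradMap lam z hhat)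

end Estimator

/-! ### Preference feedback, the algorithm and its regret -/

/-- The Bradley-Terry probability that `a` is preferred over `b` when the utility is `f`. -/
def prefProb {A : Type*} (f : A → ℝ) (a b : A) : ℝ := Real.sigmoid (f a - f b)

/-- The first `t` terms of a process. -/
def past {Ω E : Type*} (u : ℕ → Ω → E) (t : ℕ) (ω : Ω) : Fin t → E := fun i => u i ω

/-- Interaction with binary preference feedback. Rounds are numbered from `0`: in round `t` the
pair `z t` is chosen from the information `ℱ t` (the past pairs and feedback and, possibly, extra
randomness of the agent), and then the feedback `y t` is `1` with conditional probability
`s(f(x_t) - f(x'_t))` and `0` otherwise. -/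
structure IsPreferenceInteraction {A Ω : Type*} [MeasurableSpace A] {mΩ : MeasurableSpace Ω}
    (μ : Measure Ω) (ℱ : Filtration ℕ mΩ) (f : A → ℝ)
    (z : ℕ → Ω → A × A) (y : ℕ → Ω → ℝ) : Prop where
  measurable_action : ∀ t, Measurable[ℱ t] (z t)
  measurable_feedback : ∀ t, Measurable[ℱ (t + 1)] (y t)
  binary : ∀ t, ∀ᵐ ω ∂μ, y t ω = 0 ∨ y t ω = 1
  condProb : ∀ t, μ[y t | ℱ t] =ᵐ[μ] fun ω => prefProb f (z t ω).1 (z t ω).2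

/-- The plausible maximizers `{x | ∀ x', s(h(x,x')) + b σ(x,x') ≥ 1/2}`. -/
def plausible {A : Type*} (h σ : A × A → ℝ) (b : ℝ) : Set A :=
  {x | ∀ x' : A, 1 / 2 ≤ Real.sigmoid (h (x, x')) + b * σ (x, x')}

/-- `p` is a most informative pair of plausible maximizers. -/
def IsMaxInPChoice {A : Type*} (h σ : A × A → ℝ) (b : ℝ) (p : A × A) : Prop :=
  p.1 ∈ plausible h σ b ∧ p.2 ∈ plausible h σ b ∧
    ∀ a ∈ plausible h σ b, ∀ a' ∈ plausible h σ b, σ (a, a') ≤ σ p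

/-- The cumulative dueling regret of the first `T` rounds. -/
def duelingRegret {A Ω : Type*} (f : A → ℝ) (xstar : A) (z : ℕ → Ω → A × A) (T : ℕ) (ω : Ω) : ℝ :=
  ∑ t ∈ Finset.range T,
    (prefProb f xstar (z t ω).1 + prefProb f xstar (z t ω).2 - 1) / 2

end DuelingBandit

end

/-! The differences f(x) - f(x') form an element g of the dueling RKHS with norm at most B
(`exists_dueling_utility`), so the feedback is logistic regression data for g at the played pairs.
First-order optimality of the estimator gives g_t(ĥ_t) - g_t(g) = S_t - λg, where S_t = ∑ (y_i -
s(g(z_i))) φ(z_i) is the noise. The gradient map is strongly monotone on the B-ball relative to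
V_t/κ, so h_t(p) - g(p) is at most κ ‖g_t(h_t) - g_t(g)‖ ‖φ(p)‖ in absolute value, both norms being
those of V_t⁻¹. By `sigma_eq` the last factor is σ_t(p)/√(λκ).

The noise is controlled by the potential exp(2‖S_t‖²)/√det(I + (λκ)⁻¹K_t), again in the V_t⁻¹ norm.
It is a nonnegative supermartingale started at 1: rank-one updates of V_t⁻¹ and of the determinant
reduce the one-step claim to the scalar inequality `bernoulli_mixture_le`. Ville's inequality at
level 1/δ then gives 2‖S_t‖² ≤ γ_t + log(1/δ) for all t at once. This is the only probabilistic
input; the rest is pathwise, so the estimators need not be measurable in ω.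

On this event s(h_t) is within (m/4) β_t σ_t of s(g), where m = 2 is the price of the projection and
m = 1 when none takes place (`abs_sigmoid_sub_le_beta`). Hence x⋆ stays plausible, and a plausible x
trails it by at most (1 + m/4) β_t σ_t(x, x⋆), which the maximality of the played pair bounds by the
width of that pair (`round_regret_le`). The elliptical potential bound and Cauchy-Schwarz sum the
widths (`sum_sigma_le`), with constant (1 + m/4)√8: this is 3√2 for m = 2, and 5/√2 ≤ 4 for m = 1.
-/

noncomputable section

namespace DuelingBandit

/-! ### Exponential moments of Bernoulli noise -/

/-- Hoeffding's lemma for a centred Bernoulli variable. -/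
lemma bernoulli_mgf_le {p : ℝ} (hp0 : 0 ≤ p) (hp1 : p ≤ 1) (θ : ℝ) :
    p * Real.exp (θ * (1 - p)) + (1 - p) * Real.exp (θ * (-p)) ≤ Real.exp (θ ^ 2 / 8) := by
  -- The law of the centred variable. Its support lies in an interval of length 1, so the variance
  -- proxy is 1/4, whence θ²/8.
  let ν : Measure ℝ := ENNReal.ofReal p • Measure.dirac (1 - p)
    + ENNReal.ofReal (1 - p) • Measure.dirac (-p)
  have hν : IsProbabilityMeasure ν := ⟨by
    simp only [ν, Measure.add_apply, Measure.smul_apply, measure_univ, smul_eq_mul, mul_one]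
    rw [← ENNReal.ofReal_add hp0 (by linarith)]
    simp⟩
  have hint : ∀ g : ℝ → ℝ, ∫ x, g x ∂ν = p * g (1 - p) + (1 - p) * g (-p) := by
    intro g
    have h1 : Integrable g (ENNReal.ofReal p • Measure.dirac (1 - p)) :=
      (integrable_dirac (by simp)).smul_measure (by simp)
    have h2 : Integrable g (ENNReal.ofReal (1 - p) • Measure.dirac (-p)) :=
      (integrable_dirac (by simp)).smul_measure (by simp)
    rw [integral_add_measure h1 h2, integral_smul_measure, integral_smul_measure,
      integral_dirac, integral_dirac, ENNReal.toReal_ofReal hp0,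
      ENNReal.toReal_ofReal (by linarith)]
    simp
  have hb : ∀ᵐ x ∂ν, id x ∈ Set.Icc (-p) (1 - p) := by
    have hmeas : MeasurableSet {x : ℝ | id x ∈ Set.Icc (-p) (1 - p)} := measurableSet_Icc
    refine ae_add_measure_iff.2 ⟨?_, ?_⟩
    · refine Measure.ae_smul_measure ?_ _
      rw [ae_dirac_iff hmeas]; constructor <;> simp
    · refine Measure.ae_smul_measure ?_ _
      rw [ae_dirac_iff hmeas]; constructor <;> simp
  have hc : ∫ x, id x ∂ν = 0 := by rw [hint]; simp; ring
  have h := (hasSubgaussianMGF_of_mem_Icc_of_integral_eq_zero aemeasurable_id hb hc).mgf_le θ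
  rw [mgf, hint] at h
  simp only [id] at h
  refine h.trans (le_of_eq ?_)
  congr 1
  simp
  ring

lemma integrable_exp_quadratic {b : ℝ} (hb : 0 < b) (a : ℝ) :
    Integrable fun x : ℝ => Real.exp (a * x - b * x ^ 2) := by
  have h := ((integrable_exp_neg_mul_sq hb).comp_sub_right (a / (2 * b))).const_mul
    (Real.exp (a ^ 2 / (4 * b)))
  refine h.congr (Filter.Eventually.of_forall fun x => ?_)
  simp only
  rw [← Real.exp_add]
  congr 1
  field_simp
  ring

lemma integral_exp_quadratic {b : ℝ} (hb : 0 < b) (a : ℝ) :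
    ∫ x : ℝ, Real.exp (a * x - b * x ^ 2) = √(Real.pi / b) * Real.exp (a ^ 2 / (4 * b)) := by
  have h : ∀ x : ℝ, Real.exp (a * x - b * x ^ 2)
      = Real.exp (a ^ 2 / (4 * b)) * Real.exp (-b * (x - a / (2 * b)) ^ 2) := by
    intro x
    rw [← Real.exp_add]
    congr 1
    field_simp
    ring
  simp_rw [h]
  rw [integral_const_mul, integral_sub_right_eq_self (fun x => Real.exp (-b * x ^ 2)),
    integral_gaussian, mul_comm]

/-- Gaussian mixture bound: the one-step inequality behind the self-normalised supermartingale. -/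
lemma bernoulli_mixture_le {p w : ℝ} (hp0 : 0 ≤ p) (hp1 : p ≤ 1) (hw : 0 ≤ w) (u : ℝ) :
    p * Real.exp (2 * ((2 * (1 - p) * u + (1 - p) ^ 2 * w - u ^ 2) / (1 + w)))
      + (1 - p) * Real.exp (2 * ((2 * (-p) * u + (-p) ^ 2 * w - u ^ 2) / (1 + w)))
      ≤ √(1 + w) := by
  have h1w : (0 : ℝ) < 1 + w := by linarith
  set r : ℝ := 1 / (1 + w) with hr
  have hr0 : 0 < r := by positivity
  have hr1 : 1 - r = w / (1 + w) := by rw [hr]; field_simp; ring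
  set s : ℝ := √(1 - r) with hs
  have hs2 : s ^ 2 = 1 - r := Real.sq_sqrt (by rw [hr1]; positivity)
  have hpi : 0 < √(Real.pi / (1 / 2)) := by positivity
  -- Gaussian linearisation: averaging over x turns an exponent linear in e into the required
  -- quadratic one. With s² = w/(1+w) the x-integral produces the e² term, so Hoeffding's lemma can
  -- be applied for each fixed x with θ = 4ur + 2sx.
  have key : ∀ e : ℝ, ∫ x : ℝ, Real.exp ((4 * u * r + 2 * s * x) * e - 1 / 2 * x ^ 2 - 2 * u ^ 2 * r)
      = √(Real.pi / (1 / 2)) * Real.exp (2 * ((2 * e * u + e ^ 2 * w - u ^ 2) / (1 + w))) := by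
    intro e
    have : ∀ x : ℝ, Real.exp ((4 * u * r + 2 * s * x) * e - 1 / 2 * x ^ 2 - 2 * u ^ 2 * r)
        = Real.exp (4 * u * r * e - 2 * u ^ 2 * r)
          * Real.exp ((2 * s * e) * x - 1 / 2 * x ^ 2) := by
      intro x; rw [← Real.exp_add]; ring_nf
    simp_rw [this]
    rw [integral_const_mul, integral_exp_quadratic (by norm_num), mul_left_comm, ← Real.exp_add]
    congr 2
    have : (2 * s * e) ^ 2 / (4 * (1 / 2)) = 2 * e ^ 2 * (w / (1 + w)) := by
      rw [← hr1, ← hs2]; ring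
    rw [this, hr]
    field_simp
    ring
  have hintg : ∀ e : ℝ, Integrable fun x : ℝ =>
      Real.exp ((4 * u * r + 2 * s * x) * e - 1 / 2 * x ^ 2 - 2 * u ^ 2 * r) := by
    intro e
    refine ((integrable_exp_quadratic (b := 1 / 2) (by norm_num) (2 * s * e)).const_mul
      (Real.exp (4 * u * r * e - 2 * u ^ 2 * r))).congr (Filter.Eventually.of_forall fun x => ?_)
    simp only
    rw [← Real.exp_add]; ring_nf
  have hquad : ∀ x : ℝ, (4 * u * r + 2 * s * x) ^ 2 / 8 - 1 / 2 * x ^ 2 - 2 * u ^ 2 * r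
      = (2 * u * r * s) * x - r / 2 * x ^ 2 + (2 * u ^ 2 * r ^ 2 - 2 * u ^ 2 * r) := by
    intro x
    have : s ^ 2 * x ^ 2 = (1 - r) * x ^ 2 := by rw [hs2]
    linear_combination this / 2
  have hle : ∫ x : ℝ,
      (p * Real.exp ((4 * u * r + 2 * s * x) * (1 - p) - 1 / 2 * x ^ 2 - 2 * u ^ 2 * r)
        + (1 - p) * Real.exp ((4 * u * r + 2 * s * x) * (-p) - 1 / 2 * x ^ 2 - 2 * u ^ 2 * r))
      ≤ ∫ x : ℝ, Real.exp ((2 * u * r * s) * x - r / 2 * x ^ 2)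
          * Real.exp (2 * u ^ 2 * r ^ 2 - 2 * u ^ 2 * r) := by
    refine integral_mono (((hintg _).const_mul _).add ((hintg _).const_mul _))
      ((integrable_exp_quadratic (by positivity) _).mul_const _) fun x => ?_
    simp only
    rw [← Real.exp_add, ← hquad]
    have h := mul_le_mul_of_nonneg_right (bernoulli_mgf_le hp0 hp1 (4 * u * r + 2 * s * x))
      (Real.exp_pos (- (1 / 2 * x ^ 2) - 2 * u ^ 2 * r)).le
    rw [add_mul, mul_assoc p, mul_assoc (1 - p), ← Real.exp_add, ← Real.exp_add,
      ← Real.exp_add] at h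
    convert! h using 2 <;> ring_nf
  rw [integral_add ((hintg _).const_mul _) ((hintg _).const_mul _), integral_const_mul,
    integral_const_mul, key, key, integral_mul_const, integral_exp_quadratic (by positivity),
    mul_assoc (√_) (Real.exp _) (Real.exp _), ← Real.exp_add] at hle
  -- All dependence on u cancels; only the ratio √(1+w) of the two Gaussian normalisations
  -- (precision r against precision 1) survives.
  have hz : (2 * u * r * s) ^ 2 / (4 * (r / 2)) + (2 * u ^ 2 * r ^ 2 - 2 * u ^ 2 * r) = 0 := by
    have : (2 * u * r * s) ^ 2 / (4 * (r / 2)) = 2 * u ^ 2 * r * s ^ 2 := by field_simp; ring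
    rw [this, hs2]; ring
  have hsq : √(Real.pi / (r / 2)) = √(Real.pi / (1 / 2)) * √(1 + w) := by
    rw [← Real.sqrt_mul (by positivity)]
    congr 1
    rw [hr]; field_simp
  rw [hz, Real.exp_zero, mul_one, hsq] at hle
  refine le_of_mul_le_mul_left ?_ hpi
  linarith

/-- Concavity of the logarithm: `x ↦ log (1 + x / c)` lies above its chord on `[0, a]`. -/
lemma mul_log_le_mul_log {a c x : ℝ} (ha : 0 < a) (hc : 0 < c) (hx0 : 0 ≤ x) (hxa : x ≤ a) :
    x * Real.log (1 + a / c) ≤ a * Real.log (1 + x / c) := by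
  have hy : 1 + a / c ∈ Set.Ioi (0 : ℝ) := by simp only [Set.mem_Ioi]; positivity
  have hx1 : 0 ≤ 1 - x / a := by rw [sub_nonneg, div_le_one ha]; exact hxa
  have hx2 : 0 ≤ x / a := by positivity
  have h := strictConcaveOn_log_Ioi.concaveOn.2 (Set.mem_Ioi.2 one_pos) hy hx1 hx2 (by ring)
  simp only [smul_eq_mul, Real.log_one, mul_zero, zero_add, mul_one] at h
  have e : 1 - x / a + x / a * (1 + a / c) = 1 + x / c := by field_simp; ring
  rw [e] at h
  have := mul_le_mul_of_nonneg_left h ha.le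
  calc x * Real.log (1 + a / c) = a * (x / a * Real.log (1 + a / c)) := by field_simp
    _ ≤ _ := this

/-! ### Slopes of the sigmoid on a bounded interval -/

lemma sigmoidSlope_pos (a : ℝ) : 0 < sigmoidSlope a :=
  mul_pos (Real.sigmoid_pos a) (by linarith [Real.sigmoid_lt_one a])

lemma continuous_sigmoidSlope : Continuous sigmoidSlope := by
  unfold sigmoidSlope
  exact continuous_sigmoid.mul (continuous_const.sub continuous_sigmoid)

lemma sigmoidSlope_le_slopeSup {r a : ℝ} (ha : a ∈ Set.Icc (-r) r) :
    sigmoidSlope a ≤ slopeSup r :=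
  le_csSup (isCompact_Icc.bddAbove_image continuous_sigmoidSlope.continuousOn)
    (Set.mem_image_of_mem _ ha)

lemma one_div_sigmoidSlope_le_kappa {r a : ℝ} (ha : a ∈ Set.Icc (-r) r) :
    1 / sigmoidSlope a ≤ kappa r :=
  le_csSup (isCompact_Icc.bddAbove_image
    (continuous_const.div continuous_sigmoidSlope fun x => (sigmoidSlope_pos x).ne').continuousOn)
    (Set.mem_image_of_mem (fun a => 1 / sigmoidSlope a) ha)

lemma slopeSup_pos {r : ℝ} (hr : 0 ≤ r) : 0 < slopeSup r :=
  (sigmoidSlope_pos 0).trans_le (sigmoidSlope_le_slopeSup ⟨by linarith, hr⟩)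

lemma kappa_pos {r : ℝ} (hr : 0 ≤ r) : 0 < kappa r :=
  (one_div_pos.2 (sigmoidSlope_pos 0)).trans_le (one_div_sigmoidSlope_le_kappa ⟨by linarith, hr⟩)

/-- Mean value theorem, with m a value of the slope inside the interval. Writing it as a product
rather than a quotient lets a = b be included; the Lipschitz bound and the strong monotonicity below
are both read off from m. -/
lemma sigmoid_sub_mem {r a b : ℝ} (ha : a ∈ Set.Icc (-r) r) (hb : b ∈ Set.Icc (-r) r) :
    ∃ m, 0 < m ∧ m ≤ slopeSup r ∧ 1 ≤ kappa r * m ∧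
      Real.sigmoid a - Real.sigmoid b = m * (a - b) := by
  rcases lt_trichotomy a b with h | h | h
  · obtain ⟨x, hx, hx'⟩ := exists_hasDerivAt_eq_slope Real.sigmoid sigmoidSlope h
      continuous_sigmoid.continuousOn fun x _ => Real.hasDerivAt_sigmoid x
    have hxr : x ∈ Set.Icc (-r) r := ⟨ha.1.trans hx.1.le, hx.2.le.trans hb.2⟩
    have h1 := one_div_sigmoidSlope_le_kappa hxr
    rw [div_le_iff₀ (sigmoidSlope_pos x)] at h1
    refine ⟨_, sigmoidSlope_pos x, sigmoidSlope_le_slopeSup hxr, h1, ?_⟩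
    rw [hx']
    have : b - a ≠ 0 := by linarith
    field_simp; ring
  · have h1 := one_div_sigmoidSlope_le_kappa ha
    rw [div_le_iff₀ (sigmoidSlope_pos a)] at h1
    exact ⟨_, sigmoidSlope_pos a, sigmoidSlope_le_slopeSup ha, h1, by simp [h]⟩
  · obtain ⟨x, hx, hx'⟩ := exists_hasDerivAt_eq_slope Real.sigmoid sigmoidSlope h
      continuous_sigmoid.continuousOn fun x _ => Real.hasDerivAt_sigmoid x
    have hxr : x ∈ Set.Icc (-r) r := ⟨hb.1.trans hx.1.le, hx.2.le.trans ha.2⟩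
    have h1 := one_div_sigmoidSlope_le_kappa hxr
    rw [div_le_iff₀ (sigmoidSlope_pos x)] at h1
    refine ⟨_, sigmoidSlope_pos x, sigmoidSlope_le_slopeSup hxr, h1, ?_⟩
    rw [hx']
    have : a - b ≠ 0 := by linarith
    field_simp

lemma abs_sigmoid_sub_le {r a b : ℝ} (ha : a ∈ Set.Icc (-r) r) (hb : b ∈ Set.Icc (-r) r) :
    |Real.sigmoid a - Real.sigmoid b| ≤ slopeSup r * |a - b| := by
  obtain ⟨m, hm, hmL, -, h⟩ := sigmoid_sub_mem ha hb
  rw [h, abs_mul, abs_of_pos hm]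
  gcongr

lemma sq_sub_le_kappa_mul {r a b : ℝ} (ha : a ∈ Set.Icc (-r) r) (hb : b ∈ Set.Icc (-r) r) :
    (a - b) ^ 2 ≤ kappa r * ((Real.sigmoid a - Real.sigmoid b) * (a - b)) := by
  obtain ⟨m, -, -, hκ, h⟩ := sigmoid_sub_mem ha hb
  rw [h]
  nlinarith [sq_nonneg (a - b)]

/-! ### The regularised covariance operator and its dual norm -/

section Covariance

variable {Z : Type*} {H : Type*} [NormedAddCommGroup H] [InnerProductSpace ℝ H]
  [CompleteSpace H] [RKHS ℝ H Z ℝ]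

lemma inner_feature (x : Z) (h : H) : inner ℝ (feature H x) h = h x := by
  simp [feature]

lemma inner_feature_right (x : Z) (h : H) : inner ℝ h (feature H x) = h x := by
  rw [real_inner_comm, inner_feature]

lemma inner_feature_feature (x y : Z) :
    inner ℝ (feature H x) (feature H y) = kern H x y := by
  rw [inner_feature, feature, RKHS.kerFun_apply, kern]

lemma feature_apply (x y : Z) : (feature H y) x = kern H x y := by
  rw [← inner_feature_feature, inner_feature]

lemma kern_comm (x y : Z) : kern H x y = kern H y x := by
  rw [← inner_feature_feature, real_inner_comm, inner_feature_feature]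

lemma norm_feature_sq (x : Z) : ‖feature H x‖ ^ 2 = kern H x x := by
  rw [← inner_feature_feature, real_inner_self_eq_norm_sq]

variable {t : ℕ} {c : ℝ} (z : Fin t → Z)

lemma covOp_apply (v : H) :
    covOp H c z v = (∑ i, v (z i) • feature H (z i)) + c • v := by
  simp [covOp, InnerProductSpace.rankOne_apply, inner_feature]

lemma inner_covOp (v w : H) :
    inner ℝ v (covOp H c z w) = (∑ i, v (z i) * w (z i)) + c * inner ℝ v w := by
  rw [covOp_apply, inner_add_right, inner_sum]
  simp only [inner_smul_right, inner_feature_right]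
  congr 1
  exact Finset.sum_congr rfl fun i _ => mul_comm _ _

lemma mul_norm_sq_le_inner_covOp (v : H) : c * ‖v‖ ^ 2 ≤ inner ℝ v (covOp H c z v) := by
  rw [inner_covOp, real_inner_self_eq_norm_sq]
  have : 0 ≤ ∑ i, v (z i) * v (z i) := Finset.sum_nonneg fun i _ => mul_self_nonneg _
  linarith

/-- Lax-Milgram: the form of V is coercive with constant c. This makes `ContinuousLinearMap.inverse`
a genuine inverse. -/
lemma isUnit_covOp (hc : 0 < c) : IsUnit (covOp H c z) := by
  refine ContinuousLinearMap.isUnit_of_forall_le_norm_inner_map _ (c := ⟨c, hc.le⟩) hc fun x => ?_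
  rw [real_inner_comm]
  refine le_trans ?_ (Real.le_norm_self _)
  rw [mul_comm]
  exact mul_norm_sq_le_inner_covOp z x

lemma covOp_inverse_apply (hc : 0 < c) (v : H) : covOp H c z ((covOp H c z).inverse v) = v := by
  rw [← ContinuousLinearMap.ringInverse_eq_inverse]
  have := Ring.mul_inverse_cancel _ (isUnit_covOp (H := H) z hc)
  exact DFunLike.congr_fun this v

lemma inverse_covOp_apply (hc : 0 < c) (v : H) : (covOp H c z).inverse (covOp H c z v) = v := by
  rw [← ContinuousLinearMap.ringInverse_eq_inverse]
  have := Ring.inverse_mul_cancel _ (isUnit_covOp (H := H) z hc)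
  exact DFunLike.congr_fun this v

lemma covOp_symm (v w : H) : inner ℝ v (covOp H c z w) = inner ℝ (covOp H c z v) w := by
  rw [real_inner_comm w, inner_covOp, inner_covOp, real_inner_comm w v]
  simp only [mul_comm]

lemma inverse_covOp_symm (hc : 0 < c) (v w : H) :
    inner ℝ v ((covOp H c z).inverse w) = inner ℝ ((covOp H c z).inverse v) w := by
  conv_lhs => rw [← covOp_inverse_apply z hc v]
  rw [← covOp_symm, covOp_inverse_apply z hc]

lemma inner_inverse_covOp_self (hc : 0 < c) (v : H) :
    c * ‖(covOp H c z).inverse v‖ ^ 2 ≤ inner ℝ v ((covOp H c z).inverse v) := by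
  conv_rhs => rw [← covOp_inverse_apply z hc v]
  rw [inverse_covOp_apply z hc, real_inner_comm]
  exact mul_norm_sq_le_inner_covOp z _

lemma inner_inverse_covOp_nonneg (hc : 0 < c) (v : H) :
    0 ≤ inner ℝ v ((covOp H c z).inverse v) :=
  (by positivity : 0 ≤ c * ‖(covOp H c z).inverse v‖ ^ 2).trans (inner_inverse_covOp_self z hc v)

lemma inner_inverse_covOp_le (hc : 0 < c) (v : H) :
    inner ℝ v ((covOp H c z).inverse v) ≤ ‖v‖ ^ 2 / c := by
  have h1 := inner_inverse_covOp_self z hc v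
  have h2 := real_inner_le_norm v ((covOp H c z).inverse v)
  rw [le_div_iff₀ hc]
  -- With w = V⁻¹v, combine c‖w‖² ≤ ⟨v, w⟩ ≤ ‖v‖‖w‖ so that ‖w‖ is eliminated.
  nlinarith [sq_nonneg (‖v‖ - c * ‖(covOp H c z).inverse v‖)]

/-- Cauchy-Schwarz for the form `⟨v, V⁻¹ w⟩`. -/
lemma inner_inverse_covOp_sq_le (hc : 0 < c) (v w : H) :
    (inner ℝ v ((covOp H c z).inverse w)) ^ 2
      ≤ inner ℝ v ((covOp H c z).inverse v) * inner ℝ w ((covOp H c z).inverse w) := by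
  have h : ∀ s : ℝ, 0 ≤ inner ℝ w ((covOp H c z).inverse w) * (s * s)
      + (2 * inner ℝ v ((covOp H c z).inverse w)) * s
      + inner ℝ v ((covOp H c z).inverse v) := by
    intro s
    have h := inner_inverse_covOp_nonneg z hc (v + s • w)
    have hs : inner ℝ w ((covOp H c z).inverse v) = inner ℝ v ((covOp H c z).inverse w) := by
      rw [inverse_covOp_symm z hc, real_inner_comm]
    simp only [map_add, map_smul, inner_add_left, inner_add_right, inner_smul_left,
      inner_smul_right, hs, RCLike.conj_to_real] at h
    linarith
  have := discrim_le_zero h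
  unfold discrim at this
  linarith

lemma invCovNorm_nonneg (v : H) : 0 ≤ invCovNorm c z v := Real.sqrt_nonneg _

lemma invCovNorm_sq (hc : 0 < c) (v : H) :
    invCovNorm c z v ^ 2 = inner ℝ v ((covOp H c z).inverse v) :=
  Real.sq_sqrt (inner_inverse_covOp_nonneg z hc v)

lemma abs_inner_inverse_covOp_le (hc : 0 < c) (v w : H) :
    |inner ℝ v ((covOp H c z).inverse w)| ≤ invCovNorm c z v * invCovNorm c z w := by
  refine abs_le_of_sq_le_sq ?_ (mul_nonneg (invCovNorm_nonneg z v) (invCovNorm_nonneg z w))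
  rw [mul_pow, invCovNorm_sq z hc, invCovNorm_sq z hc]
  exact inner_inverse_covOp_sq_le z hc v w

lemma invCovNorm_add_le (hc : 0 < c) (v w : H) :
    invCovNorm c z (v + w) ≤ invCovNorm c z v + invCovNorm c z w := by
  refine abs_le_of_sq_le_sq' ?_ (add_nonneg (invCovNorm_nonneg z v) (invCovNorm_nonneg z w)) |>.2
  have hs : inner ℝ w ((covOp H c z).inverse v) = inner ℝ v ((covOp H c z).inverse w) := by
    rw [inverse_covOp_symm z hc, real_inner_comm]
  have h := (le_abs_self _).trans (abs_inner_inverse_covOp_le z hc v w)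
  rw [invCovNorm_sq z hc, add_sq, invCovNorm_sq z hc, invCovNorm_sq z hc]
  simp only [map_add, inner_add_left, inner_add_right, hs]
  linarith

lemma invCovNorm_neg (v : H) : invCovNorm c z (-v) = invCovNorm c z v := by
  simp [invCovNorm]

lemma invCovNorm_sub_comm (v w : H) : invCovNorm c z (v - w) = invCovNorm c z (w - v) := by
  rw [← neg_sub, invCovNorm_neg]

lemma invCovNorm_sub_le (hc : 0 < c) (v w : H) :
    invCovNorm c z (v - w) ≤ invCovNorm c z v + invCovNorm c z w := by
  rw [sub_eq_add_neg, ← invCovNorm_neg z w]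
  exact invCovNorm_add_le z hc _ _

lemma invCovNorm_le (hc : 0 < c) (v : H) : invCovNorm c z v ≤ ‖v‖ / √c := by
  refine Real.sqrt_le_iff.2 ⟨by positivity, ?_⟩
  rw [div_pow, Real.sq_sqrt hc.le]
  exact inner_inverse_covOp_le z hc v

end Covariance

/-! ### Rank-one updates -/

section RankOne

variable {Z : Type*} {H : Type*} [NormedAddCommGroup H] [InnerProductSpace ℝ H]
  [CompleteSpace H] [RKHS ℝ H Z ℝ] {t : ℕ} {c : ℝ} (z : Fin (t + 1) → Z)

lemma covOp_succ_apply (v : H) :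
    covOp H c z v = covOp H c (fun i : Fin t => z i.castSucc) v
      + v (z (Fin.last t)) • feature H (z (Fin.last t)) := by
  rw [covOp_apply, covOp_apply, Fin.sum_univ_castSucc]
  abel

/-- The Sherman-Morrison formula. -/
lemma inverse_covOp_succ_apply (hc : 0 < c) (v : H) :
    (covOp H c z).inverse v = (covOp H c (fun i : Fin t => z i.castSucc)).inverse v
      - (inner ℝ (feature H (z (Fin.last t)))
          ((covOp H c (fun i : Fin t => z i.castSucc)).inverse v)
        / (1 + inner ℝ (feature H (z (Fin.last t)))
          ((covOp H c (fun i : Fin t => z i.castSucc)).inverse (feature H (z (Fin.last t))))))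
        • (covOp H c (fun i : Fin t => z i.castSucc)).inverse (feature H (z (Fin.last t))) := by
  set W := (covOp H c (fun i : Fin t => z i.castSucc)).inverse with hW
  set φ := feature H (z (Fin.last t)) with hφ
  have hw : 0 ≤ inner ℝ φ (W φ) := inner_inverse_covOp_nonneg _ hc φ
  set a := inner ℝ φ (W v) with ha
  set w := inner ℝ φ (W φ) with hw'
  have h1 : (1 : ℝ) + w ≠ 0 := by positivity
  have key : covOp H c z (W v - (a / (1 + w)) • W φ) = v := by
    rw [covOp_succ_apply, ← hφ, ← inner_feature, ← hφ, inner_sub_right, inner_smul_right, ← hw',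
      ← ha, map_sub, map_smul, hW, covOp_inverse_apply _ hc, covOp_inverse_apply _ hc]
    have : a - a / (1 + w) * w = a / (1 + w) := by field_simp; ring
    rw [this, sub_add_cancel]
  rw [← inverse_covOp_apply z hc (W v - (a / (1 + w)) • W φ), key]

lemma inner_inverse_covOp_succ (hc : 0 < c) (u v : H) :
    inner ℝ u ((covOp H c z).inverse v)
      = inner ℝ u ((covOp H c (fun i : Fin t => z i.castSucc)).inverse v)
        - inner ℝ u ((covOp H c (fun i : Fin t => z i.castSucc)).inverse
              (feature H (z (Fin.last t))))
          * inner ℝ (feature H (z (Fin.last t)))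
              ((covOp H c (fun i : Fin t => z i.castSucc)).inverse v)
          / (1 + inner ℝ (feature H (z (Fin.last t)))
            ((covOp H c (fun i : Fin t => z i.castSucc)).inverse
              (feature H (z (Fin.last t))))) := by
  rw [inverse_covOp_succ_apply z hc, inner_sub_right, inner_smul_right]
  ring

/-- The change of the self-normalised quadratic form when a multiple `e` of the new feature is
added. -/
lemma quadForm_succ (hc : 0 < c) (S : H) (e : ℝ) :
    inner ℝ (S + e • feature H (z (Fin.last t)))
      ((covOp H c z).inverse (S + e • feature H (z (Fin.last t))))
      = inner ℝ S ((covOp H c (fun i : Fin t => z i.castSucc)).inverse S)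
        + (2 * e * inner ℝ (feature H (z (Fin.last t)))
              ((covOp H c (fun i : Fin t => z i.castSucc)).inverse S)
            + e ^ 2 * inner ℝ (feature H (z (Fin.last t)))
              ((covOp H c (fun i : Fin t => z i.castSucc)).inverse (feature H (z (Fin.last t))))
            - (inner ℝ (feature H (z (Fin.last t)))
              ((covOp H c (fun i : Fin t => z i.castSucc)).inverse S)) ^ 2)
          / (1 + inner ℝ (feature H (z (Fin.last t)))
            ((covOp H c (fun i : Fin t => z i.castSucc)).inverse
              (feature H (z (Fin.last t))))) := by
  rw [inner_inverse_covOp_succ z hc]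
  set W := (covOp H c (fun i : Fin t => z i.castSucc)).inverse with hW
  set φ := feature H (z (Fin.last t)) with hφ
  have hw : 0 ≤ inner ℝ φ (W φ) := inner_inverse_covOp_nonneg _ hc φ
  have hs : inner ℝ S (W φ) = inner ℝ φ (W S) := by
    rw [hW, inverse_covOp_symm _ hc, real_inner_comm]
  simp only [map_add, map_smul, inner_add_left, inner_add_right, inner_smul_left,
    inner_smul_right, hs, RCLike.conj_to_real]
  have h1 : (1 : ℝ) + inner ℝ φ (W φ) ≠ 0 := by positivity
  field_simp
  ring

end RankOne

/-! ### Kernel matrices, posterior variance and information gain -/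

section KernelMatrix

variable {Z : Type*} {H : Type*} [NormedAddCommGroup H] [InnerProductSpace ℝ H]
  [CompleteSpace H] [RKHS ℝ H Z ℝ] {t : ℕ} {c : ℝ}

lemma kernelMatrix_mulVec (z : Fin t → Z) (α : Fin t → ℝ) (i : Fin t) :
    (kernelMatrix (kern H) z *ᵥ α) i = (∑ j, α j • feature H (z j)) (z i) := by
  rw [← inner_feature, inner_sum]
  simp only [inner_smul_right, inner_feature_feature, Matrix.mulVec, dotProduct, kernelMatrix,
    Matrix.of_apply]
  exact Finset.sum_congr rfl fun j _ => mul_comm _ _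

lemma kernelVec_dotProduct (z : Fin t → Z) (p : Z) (α : Fin t → ℝ) :
    kernelVec (kern H) z p ⬝ᵥ α = (∑ j, α j • feature H (z j)) p := by
  rw [← inner_feature, inner_sum]
  simp only [inner_smul_right, inner_feature_feature, dotProduct, kernelVec]
  exact Finset.sum_congr rfl fun j _ => by rw [mul_comm, kern_comm]

/-- Pairing (K + cI)α = 0 with α gives ‖∑ α_j φ(z_j)‖² + c|α|² = 0, so the kernel is trivial. -/
lemma isUnit_kernelMatrix_add (hc : 0 < c) (z : Fin t → Z) :
    IsUnit (kernelMatrix (kern H) z + c • (1 : Matrix (Fin t) (Fin t) ℝ)) := by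
  rw [← Matrix.mulVec_injective_iff_isUnit]
  refine (injective_iff_map_eq_zero' (Matrix.mulVecLin _)).2 fun α => ?_
  refine ⟨fun h => ?_, fun h => by simp [h]⟩
  have hi : ∀ i, (∑ j, α j • feature H (z j)) (z i) + c * α i = 0 := fun i => by
    have := congrFun h i
    simpa [Matrix.add_mulVec, Matrix.smul_mulVec, kernelMatrix_mulVec] using this
  set v := ∑ j, α j • feature H (z j) with hv
  have hsq : ‖v‖ ^ 2 = ∑ i, α i * v (z i) := by
    rw [← real_inner_self_eq_norm_sq]
    conv_lhs => rw [hv, inner_sum]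
    exact Finset.sum_congr rfl fun i _ => by
      rw [inner_smul_right, inner_feature_right]
  have hsum : ‖v‖ ^ 2 + c * ∑ i, α i ^ 2 = 0 := by
    rw [hsq, Finset.mul_sum, ← Finset.sum_add_distrib]
    exact Finset.sum_eq_zero fun i _ => by linear_combination α i * hi i
  have h0 : 0 ≤ ∑ i, α i ^ 2 := Finset.sum_nonneg fun i _ => sq_nonneg _
  have hz : ∑ i, α i ^ 2 = 0 := by
    have := sq_nonneg ‖v‖
    have : c * ∑ i, α i ^ 2 ≤ 0 := by linarith
    nlinarith
  funext i
  have := (Finset.sum_eq_zero_iff_of_nonneg (fun i _ => sq_nonneg (α i))).1 hz i (Finset.mem_univ i)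
  simpa using this

/-- The posterior variance is the quadratic form of the inverse covariance operator. -/
lemma kern_sub_eq (hc : 0 < c) (z : Fin t → Z) (p : Z) :
    kern H p p - kernelVec (kern H) z p ⬝ᵥ
      ((kernelMatrix (kern H) z + c • (1 : Matrix (Fin t) (Fin t) ℝ))⁻¹ *ᵥ kernelVec (kern H) z p)
      = c * inner ℝ (feature H p) ((covOp H c z).inverse (feature H p)) := by
  set M := kernelMatrix (kern H) z + c • (1 : Matrix (Fin t) (Fin t) ℝ) with hM
  set α := M⁻¹ *ᵥ kernelVec (kern H) z p with hα
  have hMα : M *ᵥ α = kernelVec (kern H) z p := by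
    rw [hα, Matrix.mulVec_mulVec, Matrix.mul_nonsing_inv _
      ((Matrix.isUnit_iff_isUnit_det _).1 (isUnit_kernelMatrix_add hc z)), Matrix.one_mulVec]
  have hi : ∀ i, (∑ j, α j • feature H (z j)) (z i) + c * α i = kern H (z i) p := fun i => by
    have := congrFun hMα i
    simpa [hM, Matrix.add_mulVec, Matrix.smul_mulVec, kernelMatrix_mulVec, kernelVec] using this
  set v := ∑ j, α j • feature H (z j) with hv
  -- Push-through identity: V⁻¹φ(p) is the residual of kernel ridge regression of φ(p) on the data
  -- features, divided by c. The equation for α says exactly that this residual, evaluated at z_i,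
  -- is cα_i.
  have hV : covOp H c z (c⁻¹ • (feature H p - v)) = feature H p := by
    rw [covOp_apply]
    have : ∀ i, (c⁻¹ • (feature H p - v)) (z i) = α i := fun i => by
      rw [RKHS.coe_smul, RKHS.coe_sub, Pi.smul_apply, Pi.sub_apply, feature_apply, ← hi i]
      simp only [smul_eq_mul]
      field_simp
      ring
    simp only [this]
    rw [← hv, smul_inv_smul₀ hc.ne']
    abel
  have hW : (covOp H c z).inverse (feature H p) = c⁻¹ • (feature H p - v) := by
    conv_lhs => rw [← hV]
    exact inverse_covOp_apply z hc _
  rw [hW, kernelVec_dotProduct, ← hv, inner_smul_right, inner_sub_right, inner_feature_feature,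
    inner_feature]
  field_simp

lemma sigma_eq (hc : 0 < c) (z : Fin t → Z) (p : Z) :
    sigma (kern H) c z p = √c * invCovNorm c z (feature H p) := by
  rw [sigma, kern_sub_eq hc, invCovNorm, Real.sqrt_mul hc.le]

lemma sigma_sq (hc : 0 < c) (z : Fin t → Z) (p : Z) :
    sigma (kern H) c z p ^ 2
      = c * inner ℝ (feature H p) ((covOp H c z).inverse (feature H p)) := by
  rw [sigma_eq hc, mul_pow, Real.sq_sqrt hc.le, invCovNorm_sq z hc]

/-- Split off the last row and column. The Schur complement of the old block is c plus the posterior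
variance of the new point, which `kern_sub_eq` turns into c(1 + ⟨φ, V⁻¹φ⟩). -/
lemma det_kernelMatrix_add_succ (hc : 0 < c) (z : Fin (t + 1) → Z) :
    (kernelMatrix (kern H) z + c • (1 : Matrix (Fin (t + 1)) (Fin (t + 1)) ℝ)).det
      = (kernelMatrix (kern H) (fun i : Fin t => z i.castSucc)
          + c • (1 : Matrix (Fin t) (Fin t) ℝ)).det
        * (c * (1 + inner ℝ (feature H (z (Fin.last t)))
            ((covOp H c (fun i : Fin t => z i.castSucc)).inverse
              (feature H (z (Fin.last t)))))) := by
  set z' : Fin t → Z := fun i => z i.castSucc with hz'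
  set p := z (Fin.last t) with hp
  set A := kernelMatrix (kern H) z' + c • (1 : Matrix (Fin t) (Fin t) ℝ) with hA
  have hAu : IsUnit A := isUnit_kernelMatrix_add hc z'
  let : Invertible A := hAu.invertible
  rw [← Matrix.det_submatrix_equiv_self (finSumFinEquiv (m := t) (n := 1))]
  have hblock : (kernelMatrix (kern H) z
      + c • (1 : Matrix (Fin (t + 1)) (Fin (t + 1)) ℝ)).submatrix
        (finSumFinEquiv (m := t) (n := 1)) (finSumFinEquiv (m := t) (n := 1))
      = Matrix.fromBlocks A (Matrix.of fun i _ => kernelVec (kern H) z' p i)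
        (Matrix.of fun _ i => kernelVec (kern H) z' p i)
        (Matrix.of fun _ _ => kern H p p + c) := by
    have hl : ∀ j : Fin 1, Fin.natAdd t j = Fin.last t := fun j => by
      ext; simp
    have hcs : ∀ i : Fin t, Fin.castAdd 1 i = i.castSucc := fun i => rfl
    ext i j
    rcases i with i | i <;> rcases j with j | j
    · simp [hA, kernelMatrix, Matrix.one_apply, hz', hcs, Matrix.add_apply]
    · simp [kernelMatrix, hz', hp, kernelVec, hl, hcs]
    · simp [kernelMatrix, hz', hp, kernelVec, hl, hcs,
        kern_comm (z (Fin.last t)), (Fin.castSucc_lt_last j).ne']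
    · simp [kernelMatrix, hp, hl, Subsingleton.elim i j]
  rw [hblock, Matrix.det_fromBlocks₁₁, Matrix.det_unique (n := Fin 1), Matrix.invOf_eq_nonsing_inv]
  congr 1
  have h := kern_sub_eq (H := H) hc z' p
  have hm : ((Matrix.of fun (_ : Fin 1) i => kernelVec (kern H) z' p i) * A⁻¹
      * Matrix.of fun i (_ : Fin 1) => kernelVec (kern H) z' p i) default default
      = kernelVec (kern H) z' p ⬝ᵥ (A⁻¹ *ᵥ kernelVec (kern H) z' p) := by
    rw [Matrix.mul_assoc]
    rfl
  rw [Matrix.sub_apply, hm]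
  simp only [Matrix.of_apply]
  linarith

/-- Adding a point multiplies the determinant by one plus its normalised posterior variance. -/
lemma det_one_add_succ (hc : 0 < c) (z : Fin (t + 1) → Z) :
    ((1 : Matrix (Fin (t + 1)) (Fin (t + 1)) ℝ) + c⁻¹ • kernelMatrix (kern H) z).det
      = ((1 : Matrix (Fin t) (Fin t) ℝ)
          + c⁻¹ • kernelMatrix (kern H) (fun i : Fin t => z i.castSucc)).det
        * (1 + inner ℝ (feature H (z (Fin.last t)))
            ((covOp H c (fun i : Fin t => z i.castSucc)).inverse
              (feature H (z (Fin.last t))))) := by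
  have h : ∀ {n : ℕ} (K : Matrix (Fin n) (Fin n) ℝ),
      ((1 : Matrix (Fin n) (Fin n) ℝ) + c⁻¹ • K).det
        = (c⁻¹) ^ n * (K + c • (1 : Matrix (Fin n) (Fin n) ℝ)).det := by
    intro n K
    have : (1 : Matrix (Fin n) (Fin n) ℝ) + c⁻¹ • K
        = c⁻¹ • (K + c • (1 : Matrix (Fin n) (Fin n) ℝ)) := by
      rw [smul_add, inv_smul_smul₀ hc.ne', add_comm]
    rw [this, Matrix.det_smul, Fintype.card_fin]
  rw [h, h, det_kernelMatrix_add_succ hc, pow_succ]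
  field_simp

lemma one_le_det (hc : 0 < c) {t : ℕ} (z : Fin t → Z) :
    1 ≤ ((1 : Matrix (Fin t) (Fin t) ℝ) + c⁻¹ • kernelMatrix (kern H) z).det := by
  induction t with
  | zero => simp
  | succ t ih =>
    rw [det_one_add_succ hc]
    have h1 := ih (fun i : Fin t => z i.castSucc)
    have h2 := inner_inverse_covOp_nonneg (fun i : Fin t => z i.castSucc) hc
      (feature H (z (Fin.last t)))
    nlinarith

lemma log_det_succ (hc : 0 < c) (z : Fin (t + 1) → Z) :
    Real.log ((1 : Matrix (Fin (t + 1)) (Fin (t + 1)) ℝ) + c⁻¹ • kernelMatrix (kern H) z).det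
      = Real.log ((1 : Matrix (Fin t) (Fin t) ℝ)
          + c⁻¹ • kernelMatrix (kern H) (fun i : Fin t => z i.castSucc)).det
        + Real.log (1 + inner ℝ (feature H (z (Fin.last t)))
            ((covOp H c (fun i : Fin t => z i.castSucc)).inverse
              (feature H (z (Fin.last t))))) := by
  rw [det_one_add_succ hc, Real.log_mul]
  · exact (zero_lt_one.trans_le (one_le_det hc _)).ne'
  · have h2 := inner_inverse_covOp_nonneg (fun i : Fin t => z i.castSucc) hc
      (feature H (z (Fin.last t)))
    positivity

variable {b : ℝ}

lemma log_det_le (hc : 0 < c) (hb : ∀ p : Z, kern H p p ≤ b) {t : ℕ} (z : Fin t → Z) :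
    Real.log ((1 : Matrix (Fin t) (Fin t) ℝ) + c⁻¹ • kernelMatrix (kern H) z).det
      ≤ t * Real.log (1 + b / c) := by
  induction t with
  | zero => simp
  | succ t ih =>
    rw [log_det_succ hc]
    have h1 := ih (fun i : Fin t => z i.castSucc)
    have h0 := inner_inverse_covOp_nonneg (fun i : Fin t => z i.castSucc) hc
      (feature H (z (Fin.last t)))
    have h2 := inner_inverse_covOp_le (fun i : Fin t => z i.castSucc) hc
      (feature H (z (Fin.last t)))
    rw [norm_feature_sq] at h2
    have h3 : kern H (z (Fin.last t)) (z (Fin.last t)) / c ≤ b / c := by gcongr; exact hb _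
    have h4 : Real.log (1 + inner ℝ (feature H (z (Fin.last t)))
            ((covOp H c (fun i : Fin t => z i.castSucc)).inverse
              (feature H (z (Fin.last t))))) ≤ Real.log (1 + b / c) :=
      Real.log_le_log (by positivity) (by linarith)
    push_cast
    linarith

/-- Without this bound the real supremum defining `infoGain` would take its default value and
dominate nothing. -/
lemma bddAbove_infoGain (hc : 0 < c) (hb : ∀ p : Z, kern H p p ≤ b) (t : ℕ) :
    BddAbove (Set.range fun z : Fin t → Z => 1 / 2 * Real.log
      ((1 : Matrix (Fin t) (Fin t) ℝ) + c⁻¹ • kernelMatrix (kern H) z).det) := by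
  refine ⟨1 / 2 * (t * Real.log (1 + b / c)), ?_⟩
  rintro _ ⟨z, rfl⟩
  have := log_det_le hc hb z
  simp only
  linarith

lemma log_det_le_infoGain (hc : 0 < c) (hb : ∀ p : Z, kern H p p ≤ b) (z : Fin t → Z) :
    1 / 2 * Real.log ((1 : Matrix (Fin t) (Fin t) ℝ) + c⁻¹ • kernelMatrix (kern H) z).det
      ≤ infoGain (kern H) c t :=
  le_ciSup (bddAbove_infoGain hc hb t) z

/-- Appending any point to a configuration multiplies the determinant by a factor at least 1. -/
lemma infoGain_mono [Nonempty Z] (hc : 0 < c) (hb : ∀ p : Z, kern H p p ≤ b) :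
    Monotone (infoGain (kern H) c) := by
  refine monotone_nat_of_le_succ fun t => ciSup_le fun z => ?_
  obtain ⟨p⟩ := ‹Nonempty Z›
  refine le_trans ?_ (log_det_le_infoGain hc hb (Fin.snoc z p : Fin (t + 1) → Z))
  rw [log_det_succ hc]
  simp only [Fin.snoc_castSucc]
  have h2 := inner_inverse_covOp_nonneg z hc (feature H (Fin.snoc (α := fun _ => Z) z p (Fin.last t)))
  have := Real.log_nonneg (le_add_of_nonneg_right (a := 1) h2)
  linarith

/-- The elliptical potential bound along a sequence of points. -/
lemma sum_sigma_sq_le (hc : 0 < c) (hb0 : 0 < b) (hb : ∀ p : Z, kern H p p ≤ b) (z : ℕ → Z)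
    (T : ℕ) :
    (∑ t ∈ Finset.range T, sigma (kern H) c (fun i : Fin t => z i) (z t) ^ 2)
      * Real.log (1 + b / c)
      ≤ b * Real.log ((1 : Matrix (Fin T) (Fin T) ℝ)
        + c⁻¹ • kernelMatrix (kern H) fun i : Fin T => z i).det := by
  induction T with
  | zero => simp
  | succ T ih =>
    rw [Finset.sum_range_succ, add_mul, log_det_succ hc, mul_add]
    refine add_le_add ih ?_
    have h0 := inner_inverse_covOp_nonneg (fun i : Fin T => z i) hc (feature H (z T))
    have h2 := inner_inverse_covOp_le (fun i : Fin T => z i) hc (feature H (z T))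
    rw [norm_feature_sq, le_div_iff₀ hc] at h2
    -- The summand σ² lies in [0, b], so the chord bound compares it with log(1 + σ²/c), the
    -- increment of the log-determinant.
    have h := mul_log_le_mul_log (x := sigma (kern H) c (fun i : Fin T => z i) (z T) ^ 2)
      hb0 hc (sq_nonneg _) (by rw [sigma_sq hc]; linarith [hb (z T)])
    refine h.trans (le_of_eq ?_)
    rw [sigma_sq hc, mul_div_cancel_left₀ _ hc.ne']
    rfl

/-- Cauchy-Schwarz over the T rounds, followed by the elliptical potential bound; the 2 under the
root comes from the factor ½ in the information gain. -/
lemma sum_sigma_le [Nonempty Z] (hc : 0 < c) (hb0 : 0 < b) (hb : ∀ p : Z, kern H p p ≤ b)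
    (z : ℕ → Z) (T : ℕ) :
    ∑ t ∈ Finset.range T, sigma (kern H) c (fun i : Fin t => z i) (z t)
      ≤ √(2 * b) / √(Real.log (1 + b / c)) * √(T * infoGain (kern H) c T) := by
  have hlog : 0 < Real.log (1 + b / c) := Real.log_pos (by simp; positivity)
  have h1 := sum_sigma_sq_le hc hb0 hb z T
  have h2 := log_det_le_infoGain hc hb (fun i : Fin T => z i)
  have h3 := sq_sum_le_card_mul_sum_sq (s := Finset.range T)
    (f := fun t => sigma (kern H) c (fun i : Fin t => z i) (z t))
  rw [Finset.card_range] at h3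
  rw [← Real.sqrt_div (by positivity), ← Real.sqrt_mul (by positivity)]
  refine Real.le_sqrt_of_sq_le (h3.trans ?_)
  rw [div_mul_eq_mul_div, le_div_iff₀ hlog, mul_assoc]
  have h4 : b * Real.log ((1 : Matrix (Fin T) (Fin T) ℝ)
        + c⁻¹ • kernelMatrix (kern H) fun i : Fin T => z i).det
      ≤ b * (2 * infoGain (kern H) c T) := by
    gcongr
    linarith
  calc _ ≤ (T : ℝ) * (b * (2 * infoGain (kern H) c T)) :=
        mul_le_mul_of_nonneg_left (h1.trans h4) (Nat.cast_nonneg T)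
    _ = _ := by ring

end KernelMatrix

/-! ### Measurability of RKHS functions and the dueling space -/

section Features

variable {A : Type*} {H : Type*} [NormedAddCommGroup H] [InnerProductSpace ℝ H]
  [CompleteSpace H] [RKHS ℝ H A ℝ]

variable (H) in
lemma topologicalClosure_span_feature :
    (Submodule.span ℝ (Set.range (feature H : A → H))).topologicalClosure = ⊤ := by
  rw [eq_top_iff, ← RKHS.kerFun_dense H]
  refine Submodule.topologicalClosure_mono (Submodule.span_le.2 ?_)
  rintro _ ⟨x, v, rfl⟩
  have : RKHS.kerFun H x v = v • feature H x := by
    rw [feature, ← map_smul, smul_eq_mul, mul_one]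
  rw [this]
  exact Submodule.smul_mem _ _ (Submodule.subset_span ⟨x, rfl⟩)

lemma measurable_feature [MeasurableSpace A]
    (hk : Measurable fun p : A × A => kern H p.1 p.2) (x : A) :
    Measurable (feature H x : A → ℝ) := by
  have h : (feature H x : A → ℝ) = (fun p : A × A => kern H p.1 p.2) ∘ fun a => (a, x) :=
    funext fun a => feature_apply a x
  rw [h]
  exact hk.comp measurable_prodMk_right

/-- Elements of a reproducing kernel Hilbert space with measurable kernel are measurable. -/
lemma measurable_coe [MeasurableSpace A]
    (hk : Measurable fun p : A × A => kern H p.1 p.2) (f : H) : Measurable (f : A → ℝ) := by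
  let M : Submodule ℝ H :=
    { carrier := {f | Measurable (f : A → ℝ)}
      add_mem' := fun {f g} hf hg => by
        simp only [Set.mem_ofPred_eq, RKHS.coe_add] at *
        exact hf.add hg
      zero_mem' := by
        simp only [Set.mem_ofPred_eq, RKHS.coe_zero]
        exact measurable_const
      smul_mem' := fun c f hf => by
        simp only [Set.mem_ofPred_eq, RKHS.coe_smul] at *
        exact hf.const_smul c }
  -- Norm convergence implies pointwise convergence because evaluations are continuous, and
  -- pointwise limits of measurable functions are measurable.
  have hM : IsClosed (M : Set H) := by
    refine IsSeqClosed.isClosed fun u g hu hg => ?_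
    refine measurable_of_tendsto_metrizable hu (tendsto_pi_nhds.2 fun x => ?_)
    exact ((RKHS.continuous_eval x).tendsto g).comp hg
  have hle : (Submodule.span ℝ (Set.range (feature H : A → H))).topologicalClosure ≤ M := by
    refine Submodule.topologicalClosure_minimal _ (Submodule.span_le.2 ?_) hM
    rintro _ ⟨x, rfl⟩
    exact measurable_feature hk x
  rw [topologicalClosure_span_feature] at hle
  exact hle (Submodule.mem_top (x := f))

variable {HD : Type*} [NormedAddCommGroup HD] [InnerProductSpace ℝ HD] [CompleteSpace HD]
  [RKHS ℝ HD (A × A) ℝ]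

/-- Utility differences of `f` lie in the space of the dueling kernel, with norm at most `‖f‖`. -/
lemma exists_dueling_utility
    (hHD : ∀ p q : A × A, kern HD p q = duelingKernel (kern H) p q) (f : H) :
    ∃ g : HD, ‖g‖ ≤ ‖f‖ ∧ ∀ p : A × A, g p = f p.1 - f p.2 := by
  let ψ : A × A → H := fun p => feature H p.1 - feature H p.2
  have hψ : ∀ p q, inner ℝ (ψ p) (ψ q) = inner ℝ (feature HD p) (feature HD q) := by
    intro p q
    rw [inner_feature_feature, hHD]
    simp only [ψ, inner_sub_left, inner_sub_right, inner_feature_feature, duelingKernel]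
    ring
  let Φ := Finsupp.linearCombination ℝ (fun p : A × A => feature HD p)
  let Ψ := Finsupp.linearCombination ℝ ψ
  -- The two families of vectors have the same Gram matrix, so φ_D(p) ↦ φ(p.1) - φ(p.2) is isometric
  -- on the span and extends to a contraction U. The utility sought is the adjoint of U applied to
  -- f.
  have hnorm : ∀ a, ‖Ψ a‖ ≤ 1 * ‖Φ a‖ := by
    intro a
    rw [one_mul]
    refine le_of_eq ((sq_eq_sq₀ (norm_nonneg _) (norm_nonneg _)).1 ?_)
    rw [← real_inner_self_eq_norm_sq, ← real_inner_self_eq_norm_sq]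
    simp only [Ψ, Φ, Finsupp.linearCombination_apply, Finsupp.sum, sum_inner, inner_sum,
      inner_smul_left, inner_smul_right, hψ]
  have hdense : DenseRange Φ := by
    have h := topologicalClosure_span_feature HD
    rw [← Finsupp.range_linearCombination] at h
    exact (Submodule.dense_iff_topologicalClosure_eq_top).2 h
  let U : HD →L[ℝ] H := Ψ.extendOfNorm Φ
  have hU : ∀ p, U (feature HD p) = ψ p := by
    intro p
    have h := LinearMap.extendOfNorm_eq (f := Ψ) (e := Φ) hdense ⟨1, hnorm⟩ (Finsupp.single p 1)
    simpa [Φ, Ψ, Finsupp.linearCombination_single] using h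
  have hU1 : ‖U‖ ≤ 1 := LinearMap.opNorm_extendOfNorm_le hdense zero_le_one hnorm
  refine ⟨U.adjoint f, ?_, fun p => ?_⟩
  · calc ‖U.adjoint f‖ ≤ ‖U.adjoint‖ * ‖f‖ := U.adjoint.le_opNorm f
      _ ≤ 1 * ‖f‖ := by
        gcongr
        rwa [LinearIsometryEquiv.norm_map]
      _ = ‖f‖ := one_mul _
  · rw [← inner_feature, ContinuousLinearMap.adjoint_inner_right, hU]
    simp only [ψ, inner_sub_left, inner_feature]

/-- Parallelogram law: ‖φ(x) - φ(x')‖² ≤ 2‖φ(x)‖² + 2‖φ(x')‖². This 4 is the one in the logarithm of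
the final constants. -/
lemma duelingKernel_self_le (hk : ∀ x : A, kern H x x ≤ 1) (p : A × A) :
    duelingKernel (kern H) p p ≤ 4 := by
  have h : 0 ≤ ‖feature H p.1 + feature H p.2‖ ^ 2 := sq_nonneg _
  rw [← real_inner_self_eq_norm_sq] at h
  simp only [inner_add_left, inner_add_right, inner_feature_feature] at h
  simp only [duelingKernel]
  linarith [hk p.1, hk p.2, kern_comm (H := H) p.1 p.2]

end Features

/-! ### The logistic estimator and its error -/

section Estimator

variable {Z : Type*} {H : Type*} [NormedAddCommGroup H] [InnerProductSpace ℝ H]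
  [CompleteSpace H] [RKHS ℝ H Z ℝ] {t : ℕ}

lemma hasDerivAt_logisticTerm (y a : ℝ) :
    HasDerivAt (fun a => -y * Real.log (Real.sigmoid a) - (1 - y) * Real.log (1 - Real.sigmoid a))
      (Real.sigmoid a - y) a := by
  have h0 : Real.sigmoid a ≠ 0 := (Real.sigmoid_pos a).ne'
  have h1 : 1 - Real.sigmoid a ≠ 0 := by linarith [Real.sigmoid_lt_one a]
  have hs := Real.hasDerivAt_sigmoid a
  have h := ((hs.log h0).const_mul (-y)).sub (((hs.const_sub 1).log h1).const_mul (1 - y))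
  convert! h using 1
  field_simp
  ring

/-- First-order optimality of the regularised logistic estimator. -/
lemma gradMap_eq_of_isLogisticMinimizer {lam : ℝ} {z : Fin t → Z} {y : Fin t → ℝ} {h : H}
    (hh : IsLogisticMinimizer lam z y h) :
    gradMap lam z h = ∑ i, y i • feature H (z i) := by
  refine ext_inner_right ℝ fun v => ?_
  have hder : HasDerivAt (fun s : ℝ => logisticLoss lam z y (h + s • v))
      ((∑ i, (Real.sigmoid (h (z i)) - y i) * v (z i)) + lam / 2 * (2 * inner ℝ h v)) 0 := by
    unfold logisticLoss
    refine HasDerivAt.add (HasDerivAt.fun_sum fun i _ => ?_) (HasDerivAt.const_mul _ ?_)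
    · have hlin : HasDerivAt (fun s : ℝ => (h + s • v) (z i)) (v (z i)) 0 := by
        simp only [RKHS.coe_add, RKHS.coe_smul, Pi.add_apply, Pi.smul_apply, smul_eq_mul]
        simpa using ((hasDerivAt_id (0 : ℝ)).mul_const (v (z i))).const_add (h (z i))
      have h0 : (h + (0 : ℝ) • v) (z i) = h (z i) := by simp
      have hc := hasDerivAt_logisticTerm (y i) ((h + (0 : ℝ) • v) (z i))
      have := HasDerivAt.comp (0 : ℝ) hc hlin
      rw [h0] at this
      exact this
    · have hn : (fun s : ℝ => ‖h + s • v‖ ^ 2)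
          = fun s => ‖h‖ ^ 2 + 2 * inner ℝ h v * s + ‖v‖ ^ 2 * s ^ 2 := by
        funext s
        rw [norm_add_sq_real, inner_smul_right, norm_smul, mul_pow, Real.norm_eq_abs, sq_abs]
        ring
      rw [hn]
      have h1 := ((hasDerivAt_id (0 : ℝ)).const_mul (2 * inner ℝ h v)).const_add (‖h‖ ^ 2)
      have h2 := ((hasDerivAt_pow 2 (0 : ℝ)).const_mul (‖v‖ ^ 2))
      convert! h1.add h2 using 1
      simp
  -- Optimality is only tested along lines h + sv, so no Fréchet derivative of the loss is required.
  have hmin : IsLocalMin (fun s : ℝ => logisticLoss lam z y (h + s • v)) 0 :=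
    Filter.Eventually.of_forall fun s => by simpa using hh (h + s • v)
  have h0 := hmin.hasDerivAt_eq_zero hder
  rw [gradMap, inner_add_left, sum_inner, sum_inner]
  simp only [inner_smul_left, inner_feature, RCLike.conj_to_real]
  simp only [sub_mul, Finset.sum_sub_distrib] at h0
  linarith

variable {B lam : ℝ}

/-- Features have norm at most 2, which is why `kappa` and `slopeSup` are taken on the interval of
radius 2B. -/
lemma apply_mem_Icc (hk : ∀ p : Z, kern H p p ≤ 4) {h : H} (hh : ‖h‖ ≤ B) (p : Z) :
    h p ∈ Set.Icc (-(2 * B)) (2 * B) := by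
  have hφ : ‖feature H p‖ ≤ 2 := by
    refine abs_le_of_sq_le_sq' ?_ zero_le_two |>.2
    rw [norm_feature_sq]
    linarith [hk p]
  rw [Set.mem_Icc, ← abs_le, ← inner_feature]
  refine (abs_real_inner_le_norm _ _).trans ?_
  exact mul_le_mul hφ hh (norm_nonneg _) zero_le_two

/-- The gradient map is strongly monotone on the ball. -/
lemma abs_apply_sub_le_gradMap (hB : 0 ≤ B) (hlam : 0 < lam) (hk : ∀ p : Z, kern H p p ≤ 4)
    (z : Fin t → Z) {h g : H} (hh : ‖h‖ ≤ B) (hg : ‖g‖ ≤ B) (p : Z) :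
    |h p - g p| ≤ kappa (2 * B)
      * invCovNorm (lam * kappa (2 * B)) z (gradMap lam z h - gradMap lam z g)
      * invCovNorm (lam * kappa (2 * B)) z (feature H p) := by
  have hκ : 0 < kappa (2 * B) := kappa_pos (by positivity)
  set κ := kappa (2 * B) with hκdef
  have hc : 0 < lam * κ := by positivity
  set D := gradMap lam z h - gradMap lam z g with hD
  set V := covOp H (lam * κ) z with hV
  -- The data terms compare by `sq_sub_le_kappa_mul`; the regularisation terms agree exactly,
  -- because the ridge of V is λκ.
  have hmono : inner ℝ (h - g) (V (h - g)) ≤ κ * inner ℝ D (h - g) := by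
    rw [hV, inner_covOp, hD, gradMap, gradMap, add_sub_add_comm, ← smul_sub,
      ← Finset.sum_sub_distrib]
    simp only [← sub_smul]
    rw [inner_add_left, sum_inner, inner_smul_left, mul_add, Finset.mul_sum]
    simp only [inner_smul_left, inner_feature, RCLike.conj_to_real, RKHS.coe_sub, Pi.sub_apply]
    refine add_le_add (Finset.sum_le_sum fun i _ => ?_) (le_of_eq (by ring))
    rw [← sq]
    exact sq_sub_le_kappa_mul (apply_mem_Icc hk hh _) (apply_mem_Icc hk hg _)
  have hW : ∀ v : H, (V.inverse (V v)) = v := inverse_covOp_apply z hc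
  have hN : invCovNorm (lam * κ) z (V (h - g)) ^ 2 = inner ℝ (h - g) (V (h - g)) := by
    rw [invCovNorm_sq z hc, hW, real_inner_comm]
  have hcs := (le_abs_self _).trans (abs_inner_inverse_covOp_le z hc D (V (h - g)))
  rw [hW] at hcs
  -- Cauchy-Schwarz bounds the square of this norm by κ‖D‖ times the norm itself; cancel one factor,
  -- the case of norm zero being separate.
  have hNle : invCovNorm (lam * κ) z (V (h - g)) ≤ κ * invCovNorm (lam * κ) z D := by
    rcases (invCovNorm_nonneg (c := lam * κ) z (V (h - g))).eq_or_lt with h0 | h0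
    · rw [← h0]
      exact mul_nonneg hκ.le (invCovNorm_nonneg z _)
    · refine le_of_mul_le_mul_right ?_ h0
      rw [← sq, hN]
      calc _ ≤ κ * inner ℝ D (h - g) := hmono
        _ ≤ κ * (invCovNorm (lam * κ) z D * invCovNorm (lam * κ) z (V (h - g))) := by gcongr
        _ = _ := by ring
  have hp := abs_inner_inverse_covOp_le z hc (V (h - g)) (feature H p)
  rw [inverse_covOp_symm z hc, hW, inner_feature_right, RKHS.coe_sub, Pi.sub_apply] at hp
  exact hp.trans (mul_le_mul_of_nonneg_right hNle (invCovNorm_nonneg z _))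

/-- The noise `∑ (y_i - s(g(z_i))) φ(z_i)` of the gradient at the true function `g`. -/
def noiseSum (g : H) (z : Fin t → Z) (y : Fin t → ℝ) : H :=
  ∑ i, (y i - Real.sigmoid (g (z i))) • feature H (z i)

/-- The gradient error is noise minus the bias λg, and V⁻¹ ≤ c⁻¹ bounds the bias term. -/
lemma invCovNorm_gradMap_hhat_sub_le {c : ℝ} (hc : 0 < c) (hlam : 0 < lam) {z : Fin t → Z}
    {y : Fin t → ℝ} {hhat g : H} (hmin : IsLogisticMinimizer lam z y hhat) (hg : ‖g‖ ≤ B) :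
    invCovNorm c z (gradMap lam z hhat - gradMap lam z g)
      ≤ invCovNorm c z (noiseSum g z y) + lam * B / √c := by
  have : gradMap lam z hhat - gradMap lam z g = noiseSum g z y - lam • g := by
    rw [gradMap_eq_of_isLogisticMinimizer hmin, gradMap, noiseSum]
    simp only [sub_smul, Finset.sum_sub_distrib]
    abel
  rw [this]
  refine (invCovNorm_sub_le z hc _ _).trans (add_le_add le_rfl ?_)
  refine (invCovNorm_le z hc _).trans ?_
  rw [norm_smul, Real.norm_eq_abs, abs_of_pos hlam]
  gcongr

/-- As g competes in the projection, h is no farther from the estimator than g is; the triangle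
inequality costs the factor 2. -/
lemma invCovNorm_gradMap_proj_sub_le {c : ℝ} (hc : 0 < c) {z : Fin t → Z}
    {hhat h g : H} (hproj : IsProjection lam c B z hhat h) (hg : ‖g‖ ≤ B) :
    invCovNorm c z (gradMap lam z h - gradMap lam z g)
      ≤ 2 * invCovNorm c z (gradMap lam z hhat - gradMap lam z g) := by
  have h1 := hproj.2 g hg
  have h2 := invCovNorm_add_le z hc (gradMap lam z h - gradMap lam z hhat)
    (gradMap lam z hhat - gradMap lam z g)
  rw [sub_add_sub_cancel] at h2
  rw [invCovNorm_sub_comm z (gradMap lam z g)] at h1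
  linarith

/-- Here the estimator itself competes, so the minimal distance is 0 and nothing is lost. Only
equality of gradients is used, not that of h and the estimator. -/
lemma invCovNorm_gradMap_proj_sub_le_of_norm_le {c : ℝ} (hc : 0 < c) {z : Fin t → Z}
    {hhat h g : H} (hproj : IsProjection lam c B z hhat h) (hhat_le : ‖hhat‖ ≤ B) :
    invCovNorm c z (gradMap lam z h - gradMap lam z g)
      ≤ 1 * invCovNorm c z (gradMap lam z hhat - gradMap lam z g) := by
  have h1 := hproj.2 hhat hhat_le
  have h2 := invCovNorm_add_le z hc (gradMap lam z h - gradMap lam z hhat)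
    (gradMap lam z hhat - gradMap lam z g)
  rw [sub_add_sub_cancel] at h2
  have h3 : invCovNorm c z (gradMap lam z hhat - gradMap lam z hhat) = 0 := by
    simp [invCovNorm]
  linarith

/-- The confidence width of the link-transformed estimate, in terms of the gradient error. -/
lemma abs_sigmoid_sub_le_beta (hB : 0 ≤ B) (hlam : 0 < lam) (hk : ∀ p : Z, kern H p p ≤ 4)
    {z : Fin t → Z} {y : Fin t → ℝ} {δ m : ℝ} (hm : 0 ≤ m) {hhat h g : H}
    (hh : ‖h‖ ≤ B) (hg : ‖g‖ ≤ B) (hmin : IsLogisticMinimizer lam z y hhat)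
    (hgrad : invCovNorm (lam * kappa (2 * B)) z (gradMap lam z h - gradMap lam z g)
      ≤ m * invCovNorm (lam * kappa (2 * B)) z (gradMap lam z hhat - gradMap lam z g))
    (hnoise : 2 * invCovNorm (lam * kappa (2 * B)) z (noiseSum g z y) ^ 2
      ≤ infoGain (kern H) (lam * kappa (2 * B)) t + Real.log (1 / δ)) (p : Z) :
    |Real.sigmoid (h p) - Real.sigmoid (g p)|
      ≤ m / 4 * beta (kern H) lam B (2 * B) δ t * sigma (kern H) (lam * kappa (2 * B)) z p := by
  have hκ : 0 < kappa (2 * B) := kappa_pos (by positivity)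
  have hL : 0 < slopeSup (2 * B) := slopeSup_pos (by positivity)
  have hmv := (abs_sigmoid_sub_le (apply_mem_Icc hk hh p) (apply_mem_Icc hk hg p)).trans
    (mul_le_mul_of_nonneg_left (abs_apply_sub_le_gradMap hB hlam hk z hh hg p) hL.le)
  have hc : 0 < lam * kappa (2 * B) := by positivity
  have hgr := hgrad.trans (mul_le_mul_of_nonneg_left
    (invCovNorm_gradMap_hhat_sub_le hc hlam hmin hg) hm)
  rw [sigma_eq hc]
  unfold beta
  set κ := kappa (2 * B) with hκdef
  set L := slopeSup (2 * B) with hLdef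
  set G := infoGain (kern H) (lam * κ) t + Real.log (1 / δ) with hG
  set N := invCovNorm (lam * κ) z (noiseSum g z y) with hN
  set F := invCovNorm (lam * κ) z (feature H p) with hF
  have hF0 : 0 ≤ F := invCovNorm_nonneg z _
  have hN0 : 0 ≤ N := invCovNorm_nonneg z _
  have hsc : 0 < √(lam * κ) := Real.sqrt_pos.2 hc
  have hsc2 : √(lam * κ) ^ 2 = lam * κ := Real.sq_sqrt hc.le
  have hroot : 2 * κ * N ≤ √(2 * κ / lam * G) * √(lam * κ) := by
    rw [← Real.sqrt_mul' _ hc.le]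
    refine Real.le_sqrt_of_sq_le ?_
    have : 2 * κ / lam * G * (lam * κ) = 2 * κ ^ 2 * G := by field_simp
    rw [this]
    nlinarith [sq_nonneg κ]
  -- Noise and bias in the same unit √(λκ), which is the factor relating σ to the dual norm. The
  -- bracket times 4L is β, hence the m/4 of the conclusion.
  have hlast : κ * (N + lam * B / √(lam * κ))
      ≤ (B + 1 / 2 * √(2 * κ / lam * G)) * √(lam * κ) := by
    have h1 : κ * (lam * B / √(lam * κ)) = B * √(lam * κ) := by
      rw [← mul_div_assoc, div_eq_iff hsc.ne', mul_assoc, ← sq, hsc2]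
      ring
    rw [mul_add, h1]
    linarith
  refine hmv.trans ?_
  calc L * (κ * invCovNorm (lam * κ) z (gradMap lam z h - gradMap lam z g) * F)
      ≤ L * (κ * (m * (N + lam * B / √(lam * κ))) * F) := by gcongr
    _ = (L * m * F) * (κ * (N + lam * B / √(lam * κ))) := by ring
    _ ≤ (L * m * F) * ((B + 1 / 2 * √(2 * κ / lam * G)) * √(lam * κ)) := by gcongr
    _ = _ := by ring

end Estimator

/-! ### Ville's inequality and conditional Bernoulli averages -/

section Ville

variable {Ω : Type*} {mΩ : MeasurableSpace Ω} {μ : Measure Ω} [IsProbabilityMeasure μ]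

/-- Ville's maximal inequality for nonnegative processes with decreasing conditional means. -/
lemma measure_exists_le_of_setIntegral_le {ℱ : Filtration ℕ mΩ} {M : ℕ → Ω → ℝ}
    (hmeas : ∀ t, Measurable[ℱ t] (M t)) (hint : ∀ t, Integrable (M t) μ)
    (hnn : ∀ t ω, 0 ≤ M t ω)
    (hstep : ∀ t A, MeasurableSet[ℱ t] A → ∫ ω in A, M (t + 1) ω ∂μ ≤ ∫ ω in A, M t ω ∂μ)
    (h0 : ∫ ω, M 0 ω ∂μ ≤ 1) {a : ℝ} (ha : 0 < a) :
    MeasurableSet {ω | ∃ t, a ≤ M t ω} ∧ μ {ω | ∃ t, a ≤ M t ω} ≤ ENNReal.ofReal a⁻¹ := by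
  let A : ℕ → Set Ω := fun n => {ω | ∃ s ≤ n, a ≤ M s ω}
  have hset : ∀ t n, t ≤ n → MeasurableSet[ℱ n] {ω | a ≤ M t ω} := fun t n htn =>
    ((hmeas t).mono (ℱ.mono htn) le_rfl) measurableSet_Ici
  have hAsucc : ∀ n, A (n + 1) = A n ∪ {ω | a ≤ M (n + 1) ω} := by
    intro n
    ext ω
    constructor
    · rintro ⟨s, hs, h⟩
      rcases Nat.le_succ_iff.1 hs with h' | rfl
      · exact Or.inl ⟨s, h', h⟩
      · exact Or.inr h
    · rintro (⟨s, hs, h⟩ | h)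
      · exact ⟨s, hs.trans (Nat.le_succ n), h⟩
      · exact ⟨n + 1, le_rfl, h⟩
  have hA0 : A 0 = {ω | a ≤ M 0 ω} := by
    ext ω
    simp [A]
  have hAm : ∀ n, MeasurableSet[ℱ n] (A n) := by
    intro n
    induction n with
    | zero => rw [hA0]; exact hset 0 0 le_rfl
    | succ n ih =>
      rw [hAsucc]
      exact (ℱ.mono (Nat.le_succ n) _ ih).union (hset _ _ le_rfl)
  have hAm' : ∀ n, MeasurableSet (A n) := fun n => ℱ.le n _ (hAm n)
  have hsplit : ∀ (n : ℕ) (C D : Set Ω), MeasurableSet C → MeasurableSet D →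
      (∀ ω ∈ D, a ≤ M n ω) → a * μ.real (C ∩ D) + ∫ ω in C ∩ Dᶜ, M n ω ∂μ ≤ ∫ ω in C, M n ω ∂μ := by
    intro n C D hC hD h
    have h1 := setIntegral_ge_of_const_le_real (hC.inter hD) (measure_ne_top μ _)
      (fun ω hω => h ω hω.2) (hint n).integrableOn
    have h2 := integral_inter_add_sdiff (s := C) hD (hint n).integrableOn
    rw [Set.sdiff_eq] at h2
    linarith
  -- Invariant replacing a stopping time: A n is the event of a crossing by time n. Mass that has
  -- crossed is counted at level a and frozen, while the remainder is carried forward by `hstep`.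
  have hmain : ∀ n, a * μ.real (A n) + ∫ ω in (A n)ᶜ, M n ω ∂μ ≤ 1 := by
    intro n
    induction n with
    | zero =>
      refine le_trans ?_ h0
      have h := hsplit 0 Set.univ (A 0) MeasurableSet.univ (hAm' 0) (by
        rw [hA0]; exact fun ω hω => hω)
      simpa using h
    | succ n ih =>
      have hD : MeasurableSet {ω | a ≤ M (n + 1) ω} := ℱ.le (n + 1) _ (hset _ _ le_rfl)
      have h1 := hsplit (n + 1) (A n)ᶜ {ω | a ≤ M (n + 1) ω} (hAm' n).compl hD fun ω hω => hω
      have h2 := hstep n (A n)ᶜ (hAm n).compl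
      have h3 : μ.real (A (n + 1)) ≤ μ.real (A n) + μ.real ((A n)ᶜ ∩ {ω | a ≤ M (n + 1) ω}) := by
        refine le_trans (measureReal_mono ?_) (measureReal_union_le _ _)
        rw [hAsucc]
        intro ω hω
        by_cases h : ω ∈ A n
        · exact Or.inl h
        · exact Or.inr ⟨h, hω.resolve_left h⟩
      have h4 : (A (n + 1))ᶜ = (A n)ᶜ ∩ {ω | a ≤ M (n + 1) ω}ᶜ := by
        rw [hAsucc, Set.compl_union]
      rw [h4]
      nlinarith
  have hU : {ω | ∃ t, a ≤ M t ω} = ⋃ n, A n := by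
    ext ω
    simp only [Set.mem_iUnion]
    constructor
    · rintro ⟨t, ht⟩
      exact ⟨t, t, le_rfl, ht⟩
    · rintro ⟨n, s, -, hs⟩
      exact ⟨s, hs⟩
  rw [hU]
  refine ⟨MeasurableSet.iUnion hAm', ?_⟩
  have hmono : Monotone A := fun n m hnm ω ⟨s, hs, h⟩ => ⟨s, hs.trans hnm, h⟩
  refine le_of_tendsto (tendsto_measure_iUnion_atTop hmono) (Filter.Eventually.of_forall fun n => ?_)
  refine (ENNReal.le_ofReal_iff_toReal_le (measure_ne_top μ _) (by positivity)).2 ?_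
  change μ.real (A n) ≤ a⁻¹
  have h := hmain n
  have h5 : 0 ≤ ∫ ω in (A n)ᶜ, M n ω ∂μ := integral_nonneg (hnn n)
  rw [← one_div, le_div_iff₀ ha]
  linarith

/-- Averaging over a conditionally Bernoulli variable. -/
lemma setIntegral_bernoulli_le {m : MeasurableSpace Ω} (hm : m ≤ mΩ) {y p G₀ G₁ M : Ω → ℝ} {C : ℝ}
    (hy : Measurable[mΩ] y) (hy01 : ∀ ω, y ω = 0 ∨ y ω = 1) (hcond : μ[y | m] =ᵐ[μ] p)
    (hG₀ : Measurable[m] G₀) (hG₁ : Measurable[m] G₁)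
    (hb₀ : ∀ ω, |G₀ ω| ≤ C) (hb₁ : ∀ ω, |G₁ ω| ≤ C) (hM : Integrable M μ)
    (hle : ∀ ω, p ω * G₁ ω + (1 - p ω) * G₀ ω ≤ M ω)
    {A : Set Ω} (hA : MeasurableSet[m] A) :
    ∫ ω in A, (y ω * G₁ ω + (1 - y ω) * G₀ ω) ∂μ ≤ ∫ ω in A, M ω ∂μ := by
  have hyb : ∀ ω, |y ω| ≤ 1 := fun ω => by rcases hy01 ω with h | h <;> simp [h]
  have hyi : Integrable y μ :=
    Integrable.of_bound hy.aestronglyMeasurable 1 (Filter.Eventually.of_forall hyb)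
  have hG₀i : Integrable G₀ μ := Integrable.of_bound (hG₀.mono hm le_rfl).aestronglyMeasurable C
    (Filter.Eventually.of_forall hb₀)
  have hD : StronglyMeasurable[m] (G₁ - G₀) :=
    (Measurable.sub hG₁ hG₀).stronglyMeasurable
  have hDb : ∀ ω, ‖(G₁ - G₀) ω‖ ≤ C + C := fun ω =>
    (norm_sub_le _ _).trans (add_le_add (hb₁ ω) (hb₀ ω))
  have hDy : Integrable ((G₁ - G₀) * y) μ :=
    hyi.bdd_mul (hD.mono hm).aestronglyMeasurable (Filter.Eventually.of_forall hDb)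
  -- The integrand is affine in y with coefficients known at the earlier time, so pulling them out
  -- replaces y by p.
  have hce : μ[(G₁ - G₀) * y | m] =ᵐ[μ] (G₁ - G₀) * p :=
    (condExp_mul_of_stronglyMeasurable_left hD hDy hyi).trans
      (hcond.mono fun ω h => by simp only [Pi.mul_apply, h])
  have hDp : Integrable ((G₁ - G₀) * p) μ := integrable_condExp.congr hce
  have h1 : ∫ ω in A, ((G₁ - G₀) * y) ω ∂μ = ∫ ω in A, ((G₁ - G₀) * p) ω ∂μ := by
    rw [← setIntegral_condExp hm hDy hA]
    exact integral_congr_ae (ae_restrict_of_ae hce)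
  calc ∫ ω in A, (y ω * G₁ ω + (1 - y ω) * G₀ ω) ∂μ
      = ∫ ω in A, (((G₁ - G₀) * y) ω + G₀ ω) ∂μ := by
        refine integral_congr_ae (Filter.Eventually.of_forall fun ω => ?_)
        simp only [Pi.mul_apply, Pi.sub_apply]
        ring
    _ = ∫ ω in A, (((G₁ - G₀) * p) ω + G₀ ω) ∂μ := by
        rw [integral_add hDy.integrableOn hG₀i.integrableOn, h1,
          integral_add hDp.integrableOn hG₀i.integrableOn]
    _ ≤ ∫ ω in A, M ω ∂μ := by
        refine integral_mono (hDp.integrableOn.add hG₀i.integrableOn) hM.integrableOn fun ω => ?_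
        refine le_trans (le_of_eq ?_) (hle ω)
        simp only [Pi.mul_apply, Pi.sub_apply]
        ring

end Ville

/-! ### Self-normalised concentration -/

section SelfNormalised

variable {Z : Type*} {H : Type*} [NormedAddCommGroup H] [InnerProductSpace ℝ H]
  [CompleteSpace H] [RKHS ℝ H Z ℝ] {Ω : Type*} {c : ℝ}

/-- Induction on the number of points: Sherman-Morrison writes each such scalar as a rational
expression in kernel values. No measurability of maps into H is involved, hence no separability. -/
lemma measurable_inner_inverse_covOp [MeasurableSpace Z] {m : MeasurableSpace Ω} (hc : 0 < c)
    (hk : Measurable fun p : Z × Z => kern H p.1 p.2) {t : ℕ} {z : Fin t → Ω → Z}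
    (hz : ∀ i, Measurable (z i)) {a b : Ω → Z} (ha : Measurable a) (hb : Measurable b) :
    Measurable fun ω => inner ℝ (feature H (a ω))
      ((covOp H c (fun i => z i ω)).inverse (feature H (b ω))) := by
  induction t generalizing a b with
  | zero =>
    have h : ∀ ω, inner ℝ (feature H (a ω))
        ((covOp H c (fun i => z i ω)).inverse (feature H (b ω))) = c⁻¹ * kern H (a ω) (b ω) := by
      intro ω
      have : covOp H c (fun i => z i ω) (c⁻¹ • feature H (b ω)) = feature H (b ω) := by
        rw [covOp_apply]
        simp [smul_inv_smul₀ hc.ne']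
      conv_lhs => rw [← this]
      rw [inverse_covOp_apply _ hc, inner_smul_right, inner_feature_feature]
    simp only [h]
    exact (hk.comp (ha.prodMk hb)).const_mul _
  | succ t ih =>
    simp only [inner_inverse_covOp_succ _ hc]
    have hz' : ∀ i : Fin t, Measurable (z i.castSucc) := fun i => hz _
    have hl := hz (Fin.last t)
    exact (ih hz' ha hb).sub (((ih hz' ha hl).mul (ih hz' hl hb)).div
      ((ih hz' hl hl).const_add 1))

lemma measurable_det_one_add [MeasurableSpace Z] {m : MeasurableSpace Ω} (hc : 0 < c)
    (hk : Measurable fun p : Z × Z => kern H p.1 p.2) {t : ℕ} {z : Fin t → Ω → Z}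
    (hz : ∀ i, Measurable (z i)) :
    Measurable fun ω => ((1 : Matrix (Fin t) (Fin t) ℝ)
      + c⁻¹ • kernelMatrix (kern H) fun i => z i ω).det := by
  induction t with
  | zero => simp
  | succ t ih =>
    simp only [det_one_add_succ hc]
    exact (ih fun i => hz i.castSucc).mul ((measurable_inner_inverse_covOp hc hk
      (fun i => hz i.castSucc) (hz (Fin.last t)) (hz (Fin.last t))).const_add 1)

/-- The self-normalised potential `exp (2 ‖S_t‖²_{V_t⁻¹}) / √(det (I + c⁻¹ K_t))`. -/
def potential (c : ℝ) (g : H) {t : ℕ} (z : Fin t → Z) (y : Fin t → ℝ) : ℝ :=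
  Real.exp (2 * inner ℝ (noiseSum g z y) ((covOp H c z).inverse (noiseSum g z y)))
    / √((1 : Matrix (Fin t) (Fin t) ℝ) + c⁻¹ • kernelMatrix (kern H) z).det

/-- The value of the potential one round later, if the new noise is `e` and the new point `p`. -/
def nextPotential (c : ℝ) (g : H) {t : ℕ} (z : Fin t → Z) (y : Fin t → ℝ) (p : Z) (e : ℝ) : ℝ :=
  potential c g z y * (Real.exp (2 * ((2 * e * inner ℝ (feature H p)
              ((covOp H c z).inverse (noiseSum g z y))
            + e ^ 2 * inner ℝ (feature H p) ((covOp H c z).inverse (feature H p))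
            - (inner ℝ (feature H p) ((covOp H c z).inverse (noiseSum g z y))) ^ 2)
          / (1 + inner ℝ (feature H p) ((covOp H c z).inverse (feature H p)))))
    / √(1 + inner ℝ (feature H p) ((covOp H c z).inverse (feature H p))))

lemma potential_pos (hc : 0 < c) (g : H) {t : ℕ} (z : Fin t → Z) (y : Fin t → ℝ) :
    0 < potential c g z y :=
  div_pos (Real.exp_pos _) (Real.sqrt_pos.2 (zero_lt_one.trans_le (one_le_det hc z)))

lemma potential_succ (hc : 0 < c) (g : H) {t : ℕ} (z : Fin (t + 1) → Z) (y : Fin (t + 1) → ℝ) :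
    potential c g z y = nextPotential c g (fun i : Fin t => z i.castSucc)
      (fun i : Fin t => y i.castSucc) (z (Fin.last t))
      (y (Fin.last t) - Real.sigmoid (g (z (Fin.last t)))) := by
  have h1 := one_le_det (H := H) hc (fun i : Fin t => z i.castSucc)
  have hS : noiseSum g z y = noiseSum g (fun i : Fin t => z i.castSucc)
      (fun i : Fin t => y i.castSucc)
      + (y (Fin.last t) - Real.sigmoid (g (z (Fin.last t)))) • feature H (z (Fin.last t)) := by
    rw [noiseSum, Fin.sum_univ_castSucc, noiseSum]
  rw [potential, nextPotential, potential, hS, quadForm_succ z hc, det_one_add_succ hc,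
    Real.sqrt_mul (zero_le_one.trans h1), mul_add, Real.exp_add, mul_div_mul_comm]

/-- The supermartingale step: the mixture inequality with w = ⟨φ, V⁻¹φ⟩ and u = ⟨φ, V⁻¹S⟩, whose
bound √(1+w) is exactly the growth of the normalising determinant. -/
lemma nextPotential_mean_le (hc : 0 < c) (g : H) {t : ℕ} (z : Fin t → Z) (y : Fin t → ℝ) (p : Z)
    {q : ℝ} (hq0 : 0 ≤ q) (hq1 : q ≤ 1) :
    q * nextPotential c g z y p (1 - q) + (1 - q) * nextPotential c g z y p (-q)
      ≤ potential c g z y := by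
  have hw := inner_inverse_covOp_nonneg z hc (feature H p)
  have h := bernoulli_mixture_le hq0 hq1 hw
    (inner ℝ (feature H p) ((covOp H c z).inverse (noiseSum g z y)))
  have hs : 0 < √(1 + inner ℝ (feature H p) ((covOp H c z).inverse (feature H p))) := by positivity
  have h' := (div_le_one hs).2 h
  have hP := potential_pos hc g z y
  have h'' := mul_le_mul_of_nonneg_left h' hP.le
  rw [mul_one] at h''
  refine le_trans (le_of_eq ?_) h''
  unfold nextPotential
  generalize Real.exp _ = E₁
  generalize Real.exp _ = E₂
  ring

lemma norm_noiseSum_le {R : ℝ} (hR : ∀ p : Z, ‖feature H p‖ ≤ R) (g : H) {t : ℕ} (z : Fin t → Z)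
    {y : Fin t → ℝ} (hy : ∀ i, |y i| ≤ 1) : ‖noiseSum g z y‖ ≤ t * (2 * R) := by
  refine (norm_sum_le _ _).trans ?_
  have : ∀ i ∈ Finset.univ, ‖(y i - Real.sigmoid (g (z i))) • feature H (z i)‖ ≤ 2 * R := by
    intro i _
    rw [norm_smul]
    refine mul_le_mul ?_ (hR _) (norm_nonneg _) zero_le_two
    have h1 := abs_le.1 (hy i)
    have h2 := Real.sigmoid_nonneg (g (z i))
    have h3 := Real.sigmoid_le_one (g (z i))
    exact abs_le.2 ⟨by linarith, by linarith⟩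
  refine (Finset.sum_le_card_nsmul _ _ _ this).trans ?_
  simp

/-- A crude deterministic bound at each fixed time, serving only integrability. -/
lemma potential_le (hc : 0 < c) {R : ℝ} (hR : ∀ p : Z, ‖feature H p‖ ≤ R) (g : H) {t : ℕ}
    (z : Fin t → Z) {y : Fin t → ℝ} (hy : ∀ i, |y i| ≤ 1) :
    potential c g z y ≤ Real.exp (2 * ((t * (2 * R)) ^ 2 / c)) := by
  have h1 := one_le_det (H := H) hc z
  refine (div_le_self (Real.exp_pos _).le (Real.one_le_sqrt.2 h1)).trans ?_
  have h2 := inner_inverse_covOp_le z hc (noiseSum g z y)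
  have h3 := norm_noiseSum_le hR g z hy
  gcongr
  refine h2.trans ?_
  gcongr

lemma nextPotential_abs_le (hc : 0 < c) {R : ℝ} (hR : ∀ p : Z, ‖feature H p‖ ≤ R) (g : H) {t : ℕ}
    (z : Fin t → Z) {y : Fin t → ℝ} (hy : ∀ i, |y i| ≤ 1) (p : Z) {v : ℝ} (hv : |v| ≤ 1) :
    |nextPotential c g z y p (v - Real.sigmoid (g p))|
      ≤ Real.exp (2 * (((t + 1 : ℕ) * (2 * R)) ^ 2 / c)) := by
  have h := potential_succ hc g (Fin.snoc z p : Fin (t + 1) → Z) (Fin.snoc y v : Fin (t + 1) → ℝ)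
  simp only [Fin.snoc_castSucc, Fin.snoc_last] at h
  rw [← h, abs_of_pos (potential_pos hc _ _ _)]
  refine potential_le hc hR g _ fun i => ?_
  refine Fin.lastCases ?_ (fun i => ?_) i
  · simpa using hv
  · simpa using hy i

section Measurability

variable [MeasurableSpace Z] {m : MeasurableSpace Ω} {t : ℕ} {z : Fin t → Ω → Z} {y : Fin t → Ω → ℝ}

lemma measurable_inner_noiseSum (hc : 0 < c)
    (hk : Measurable fun p : Z × Z => kern H p.1 p.2) (g : H)
    (hz : ∀ i, Measurable (z i)) (hy : ∀ i, Measurable (y i))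
    {p : Ω → Z} (hp : Measurable p) :
    Measurable fun ω => inner ℝ (feature H (p ω)) ((covOp H c fun i => z i ω).inverse
      (noiseSum g (fun i => z i ω) fun i => y i ω)) := by
  simp only [noiseSum, map_sum, map_smul, inner_sum, inner_smul_right]
  refine Finset.measurable_sum _ fun i _ => ?_
  refine Measurable.mul ?_ (measurable_inner_inverse_covOp hc hk hz hp (hz i))
  exact (hy i).sub (continuous_sigmoid.measurable.comp ((measurable_coe hk g).comp (hz i)))

lemma measurable_potential (hc : 0 < c)
    (hk : Measurable fun p : Z × Z => kern H p.1 p.2) (g : H)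
    (hz : ∀ i, Measurable (z i)) (hy : ∀ i, Measurable (y i)) :
    Measurable fun ω => potential c g (fun i => z i ω) fun i => y i ω := by
  unfold potential
  refine Measurable.div (Real.measurable_exp.comp (Measurable.const_mul ?_ _))
    (measurable_det_one_add hc hk hz).sqrt
  conv =>
    enter [1, ω, 2]
    rw [noiseSum]
  simp only [sum_inner, inner_smul_left, RCLike.conj_to_real]
  refine Finset.measurable_sum _ fun i _ => ?_
  refine Measurable.mul ?_ (measurable_inner_noiseSum hc hk g hz hy (hz i))
  exact (hy i).sub (continuous_sigmoid.measurable.comp ((measurable_coe hk g).comp (hz i)))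

lemma measurable_nextPotential (hc : 0 < c)
    (hk : Measurable fun p : Z × Z => kern H p.1 p.2) (g : H)
    (hz : ∀ i, Measurable (z i)) (hy : ∀ i, Measurable (y i))
    {p : Ω → Z} (hp : Measurable p) {e : Ω → ℝ} (he : Measurable e) :
    Measurable fun ω => nextPotential c g (fun i => z i ω) (fun i => y i ω) (p ω) (e ω) := by
  have hu := measurable_inner_noiseSum hc hk g hz hy hp
  have hw := measurable_inner_inverse_covOp hc hk hz hp hp
  have hP := measurable_potential hc hk g hz hy
  unfold nextPotential
  exact hP.mul ((Real.measurable_exp.comp (((((he.const_mul 2).mul hu).add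
    ((he.pow_const 2).mul hw)).sub (hu.pow_const 2)).div (hw.const_add 1) |>.const_mul 2)).div
    (hw.const_add 1).sqrt)

end Measurability

/-- The self-normalised concentration inequality, uniformly over time. -/
lemma measure_exists_le_potential [MeasurableSpace Z] {mΩ : MeasurableSpace Ω} {μ : Measure Ω} [IsProbabilityMeasure μ]
    {ℱ : Filtration ℕ mΩ} (hc : 0 < c) (hk : Measurable fun p : Z × Z => kern H p.1 p.2)
    {R : ℝ} (hR : ∀ p : Z, ‖feature H p‖ ≤ R) (g : H) {z : ℕ → Ω → Z} {y : ℕ → Ω → ℝ}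
    (hz : ∀ t, Measurable[ℱ t] (z t)) (hy : ∀ t, Measurable[ℱ (t + 1)] (y t))
    (hy01 : ∀ t ω, y t ω = 0 ∨ y t ω = 1)
    (hcond : ∀ t, μ[y t | ℱ t] =ᵐ[μ] fun ω => Real.sigmoid (g (z t ω))) {a : ℝ} (ha : 0 < a) :
    MeasurableSet {ω | ∃ t, a ≤ potential c g (past z t ω) (past y t ω)} ∧
      μ {ω | ∃ t, a ≤ potential c g (past z t ω) (past y t ω)} ≤ ENNReal.ofReal a⁻¹ := by
  have hzt : ∀ t (i : Fin t), Measurable[ℱ t] (z i) := fun t i =>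
    (hz i).mono (ℱ.mono i.2.le) le_rfl
  have hyt : ∀ t (i : Fin t), Measurable[ℱ t] (y i) := fun t i =>
    (hy i).mono (ℱ.mono i.2) le_rfl
  have hyb : ∀ t ω, |y t ω| ≤ 1 := fun t ω => by rcases hy01 t ω with h | h <;> simp [h]
  have hMm : ∀ t, Measurable[ℱ t] fun ω => potential c g (past z t ω) (past y t ω) :=
    fun t => measurable_potential hc hk g (hzt t) (hyt t)
  have hMi : ∀ t, Integrable (fun ω => potential c g (past z t ω) (past y t ω)) μ := fun t =>
    Integrable.of_bound ((hMm t).mono (ℱ.le t) le_rfl).aestronglyMeasurable _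
      (Filter.Eventually.of_forall fun ω => by
        rw [Real.norm_eq_abs, abs_of_pos (potential_pos hc _ _ _)]
        exact potential_le hc hR g _ fun i => hyb i ω)
  refine measure_exists_le_of_setIntegral_le hMm hMi (fun t ω => (potential_pos hc _ _ _).le)
    (fun t A hA => ?_) ?_ ha
  · have hp : Measurable[ℱ t] fun ω => Real.sigmoid (g (z t ω)) :=
      continuous_sigmoid.measurable.comp ((measurable_coe hk g).comp (hz t))
    have h := setIntegral_bernoulli_le (μ := μ) (ℱ.le t) ((hy t).mono (ℱ.le _) le_rfl) (hy01 t)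
      (hcond t)
      (measurable_nextPotential hc hk g (hzt t) (hyt t) (hz t)
        (hp.const_sub 0))
      (measurable_nextPotential hc hk g (hzt t) (hyt t) (hz t)
        (hp.const_sub 1))
      (fun ω => nextPotential_abs_le hc hR g _ (fun i => hyb i ω) _ (by simp))
      (fun ω => nextPotential_abs_le hc hR g _ (fun i => hyb i ω) _ (by simp)) (hMi t)
      (fun ω => by
        rw [zero_sub]
        exact nextPotential_mean_le hc g _ _ _ (Real.sigmoid_nonneg _) (Real.sigmoid_le_one _)) hA
    refine le_trans (le_of_eq ?_) h
    refine integral_congr_ae (Filter.Eventually.of_forall fun ω => ?_)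
    simp only
    rw [potential_succ hc]
    have e1 : past y (t + 1) ω (Fin.last t) = y t ω := rfl
    have e2 : past z (t + 1) ω (Fin.last t) = z t ω := rfl
    rw [e1, e2]
    -- The potential is not affine in y; it agrees with the interpolation between the outcomes 0 and
    -- 1 because y takes only these values.
    rcases hy01 t ω with h | h <;> rw [h] <;> simp <;> rfl
  · simp [potential, noiseSum]

end SelfNormalised

/-! ### From confidence widths to regret -/

section Regret

variable {Z : Type*} {H : Type*} [NormedAddCommGroup H] [InnerProductSpace ℝ H]
  [CompleteSpace H] [RKHS ℝ H Z ℝ] {c lam B r δ : ℝ}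

/-- Take logarithms: the root of the determinant contributes ½ log det, which the information gain
dominates. -/
lemma noise_le_of_potential_lt (hc : 0 < c) {b : ℝ} (hb : ∀ p : Z, kern H p p ≤ b) (hδ : 0 < δ)
    {g : H} {t : ℕ} {z : Fin t → Z} {y : Fin t → ℝ} (h : potential c g z y < δ⁻¹) :
    2 * invCovNorm c z (noiseSum g z y) ^ 2 ≤ infoGain (kern H) c t + Real.log (1 / δ) := by
  have h1 := one_le_det (H := H) hc z
  have hd : 0 < √((1 : Matrix (Fin t) (Fin t) ℝ) + c⁻¹ • kernelMatrix (kern H) z).det :=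
    Real.sqrt_pos.2 (zero_lt_one.trans_le h1)
  rw [potential, div_lt_iff₀ hd] at h
  have h2 := Real.log_le_log (Real.exp_pos _) h.le
  rw [Real.log_exp, Real.log_mul (by positivity) hd.ne',
    Real.log_sqrt (zero_le_one.trans h1)] at h2
  rw [invCovNorm_sq z hc, one_div]
  have h3 := log_det_le_infoGain hc hb z
  linarith

lemma beta_mono [Nonempty Z] (hlam : 0 < lam) (hr : 0 ≤ r) {b : ℝ}
    (hb : ∀ p : Z, kern H p p ≤ b) : Monotone (beta (kern H) lam B r δ) := by
  intro s t hst
  have hκ := kappa_pos hr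
  have hL := slopeSup_pos hr
  have hγ := infoGain_mono (H := H) (c := lam * kappa r) (by positivity) hb hst
  unfold beta
  gcongr

lemma beta_nonneg (hB : 0 ≤ B) (hr : 0 ≤ r) (k : Z → Z → ℝ) (t : ℕ) :
    0 ≤ beta k lam B r δ t := by
  have hL := slopeSup_pos hr
  unfold beta
  positivity

/-- The instantaneous regret of a most informative pair of plausible maximizers. -/
lemma round_regret_le {A : Type*} {f : A → ℝ} {xstar : A} (hstar : ∀ x, f x ≤ f xstar)
    {g h σ : A × A → ℝ} {w b : ℝ} (hg : ∀ p, g p = f p.1 - f p.2) (hσ : ∀ p, 0 ≤ σ p)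
    (hw0 : 0 ≤ w) (hwb : w ≤ b)
    (hwidth : ∀ p, |Real.sigmoid (h p) - Real.sigmoid (g p)| ≤ w * σ p) {p : A × A}
    (hp : IsMaxInPChoice h σ b p) :
    (prefProb f xstar p.1 + prefProb f xstar p.2 - 1) / 2 ≤ (b + w) * σ p := by
  obtain ⟨hp1, hp2, hmax⟩ := hp
  have hmem : xstar ∈ plausible h σ b := by
    intro x'
    have h1 := (abs_le.1 (hwidth (xstar, x'))).1
    have h2 : Real.sigmoid 0 ≤ Real.sigmoid (g (xstar, x')) := by
      refine Real.sigmoid_le ?_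
      rw [hg]
      linarith [hstar x']
    rw [Real.sigmoid_zero] at h2
    have h3 := mul_le_mul_of_nonneg_right hwb (hσ (xstar, x'))
    norm_num at h2 ⊢
    linarith
  -- Plausibility of x is tested against xstar, costing b; passing from h to g costs w. As both
  -- points are plausible, the played pair has at least the σ of this duel.
  have hone : ∀ x ∈ plausible h σ b, prefProb f xstar x ≤ 1 / 2 + (b + w) * σ p := by
    intro x hx
    have h1 := hx xstar
    have h2 := (abs_le.1 (hwidth (x, xstar))).2
    have h3 : prefProb f xstar x = 1 - Real.sigmoid (g (x, xstar)) := by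
      rw [prefProb, hg, ← Real.sigmoid_neg, neg_sub]
    have h4 := mul_le_mul_of_nonneg_left (hmax x hx xstar hmem) (by linarith : 0 ≤ b + w)
    rw [h3]
    linarith
  linarith [hone _ hp1, hone _ hp2]

/-- Summing instantaneous regrets bounded by multiples of the confidence widths. -/
lemma sum_regret_le [Nonempty Z] (hB : 0 ≤ B) (hlam : 0 < lam)
    (hk : ∀ p : Z, kern H p p ≤ 4) {m C : ℝ} (hm : 0 ≤ m) (hC : (1 + m / 4) * √8 ≤ C)
    (z : ℕ → Z) (ρ : ℕ → ℝ) (T : ℕ)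
    (hρ : ∀ t < T, ρ t ≤ (beta (kern H) lam B (2 * B) δ t
        + m / 4 * beta (kern H) lam B (2 * B) δ t)
      * sigma (kern H) (lam * kappa (2 * B)) (fun i : Fin t => z i) (z t)) :
    ∑ t ∈ Finset.range T, ρ t
      ≤ C / √(Real.log (1 + 4 * (lam * kappa (2 * B))⁻¹)) * beta (kern H) lam B (2 * B) δ T
        * √(T * infoGain (kern H) (lam * kappa (2 * B)) T) := by
  have hκ : 0 < kappa (2 * B) := kappa_pos (by positivity)
  have hc : 0 < lam * kappa (2 * B) := by positivity
  have hβ := beta_nonneg (lam := lam) (δ := δ) hB (by positivity : 0 ≤ 2 * B) (kern H) T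
  have hsum := sum_sigma_le hc four_pos hk z T
  rw [div_eq_mul_inv 4 (lam * kappa (2 * B)), show (2 : ℝ) * 4 = 8 by norm_num] at hsum
  calc ∑ t ∈ Finset.range T, ρ t
      ≤ ∑ t ∈ Finset.range T, (1 + m / 4) * beta (kern H) lam B (2 * B) δ T
          * sigma (kern H) (lam * kappa (2 * B)) (fun i : Fin t => z i) (z t) := by
        refine Finset.sum_le_sum fun t ht => ?_
        have htT := Finset.mem_range.1 ht
        refine (hρ t htT).trans (mul_le_mul_of_nonneg_right ?_ (Real.sqrt_nonneg _))
        have h1 : beta (kern H) lam B (2 * B) δ t ≤ beta (kern H) lam B (2 * B) δ T :=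
          beta_mono hlam (by positivity) hk htT.le
        have h2 := mul_le_mul_of_nonneg_left h1 (by positivity : 0 ≤ 1 + m / 4)
        linarith
    _ = (1 + m / 4) * beta (kern H) lam B (2 * B) δ T * ∑ t ∈ Finset.range T,
          sigma (kern H) (lam * kappa (2 * B)) (fun i : Fin t => z i) (z t) := by
        rw [Finset.mul_sum]
    _ ≤ (1 + m / 4) * beta (kern H) lam B (2 * B) δ T
          * (√8 / √(Real.log (1 + 4 * (lam * kappa (2 * B))⁻¹))
            * √(T * infoGain (kern H) (lam * kappa (2 * B)) T)) := by gcongr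
    _ = ((1 + m / 4) * √8) / √(Real.log (1 + 4 * (lam * kappa (2 * B))⁻¹))
          * beta (kern H) lam B (2 * B) δ T
          * √(T * infoGain (kern H) (lam * kappa (2 * B)) T) := by ring
    _ ≤ _ := by gcongr

lemma regret_constants : (1 + 2 / 4) * √8 ≤ 3 * √2 ∧ (1 + 1 / 4) * √8 ≤ 4 := by
  have h8 : √8 = 2 * √2 := by
    rw [show (8 : ℝ) = 2 ^ 2 * 2 by norm_num, Real.sqrt_mul (by norm_num), Real.sqrt_sq zero_le_two]
  have h2 : √2 ≤ 3 / 2 := Real.sqrt_le_iff.2 (by norm_num)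
  rw [h8]
  constructor <;> linarith

end Regret

/-- The binary feedback process may be taken to be binary everywhere. -/
lemma exists_binary_modification {Ω : Type*} {mΩ : MeasurableSpace Ω} {μ : Measure Ω}
    {ℱ : Filtration ℕ mΩ} {y : ℕ → Ω → ℝ} (hy : ∀ t, Measurable[ℱ (t + 1)] (y t))
    (hy01 : ∀ t, ∀ᵐ ω ∂μ, y t ω = 0 ∨ y t ω = 1) :
    ∃ y' : ℕ → Ω → ℝ, (∀ t, Measurable[ℱ (t + 1)] (y' t)) ∧ (∀ t ω, y' t ω = 0 ∨ y' t ω = 1) ∧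
      ∀ t, y' t =ᵐ[μ] y t := by
  refine ⟨fun t => (y t ⁻¹' {1}).indicator fun _ => 1, fun t => ?_, fun t ω => ?_, fun t => ?_⟩
  · exact measurable_const.indicator (hy t (measurableSet_singleton 1))
  · by_cases h : y t ω = 1 <;> simp [Set.indicator, h]
  · filter_upwards [hy01 t] with ω h
    rcases h with h | h <;> simp [Set.indicator, h]

lemma measurable_duelingKernel {A : Type*} [MeasurableSpace A] {k : A → A → ℝ}
    (hk : Measurable fun p : A × A => k p.1 p.2) :
    Measurable fun p : (A × A) × (A × A) => duelingKernel k p.1 p.2 := by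
  have h1 : Measurable fun p : (A × A) × (A × A) => k p.1.1 p.2.1 :=
    hk.comp (by fun_prop : Measurable fun p : (A × A) × (A × A) => (p.1.1, p.2.1))
  have h2 : Measurable fun p : (A × A) × (A × A) => k p.1.2 p.2.2 :=
    hk.comp (by fun_prop : Measurable fun p : (A × A) × (A × A) => (p.1.2, p.2.2))
  have h3 : Measurable fun p : (A × A) × (A × A) => k p.1.1 p.2.2 :=
    hk.comp (by fun_prop : Measurable fun p : (A × A) × (A × A) => (p.1.1, p.2.2))
  have h4 : Measurable fun p : (A × A) × (A × A) => k p.1.2 p.2.1 :=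
    hk.comp (by fun_prop : Measurable fun p : (A × A) × (A × A) => (p.1.2, p.2.1))
  exact ((h1.add h2).sub h3).sub h4

end DuelingBandit

end

/-! ### The main theorem -/

theorem mainTheorem6
    {d : ℕ} (X : Set (EuclideanSpace ℝ (Fin d))) (hX : IsCompact X)
    {H : Type*} [NormedAddCommGroup H] [InnerProductSpace ℝ H] [CompleteSpace H] [RKHS ℝ H X ℝ]
    (hkmeas : Measurable fun p : X × X => DuelingBandit.kern H p.1 p.2)
    (hk : ∀ x : X, DuelingBandit.kern H x x ≤ 1)
    {HD : Type*} [NormedAddCommGroup HD] [InnerProductSpace ℝ HD] [CompleteSpace HD]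
    [RKHS ℝ HD (X × X) ℝ]
    (hHD : ∀ p q : X × X,
      DuelingBandit.kern HD p q = DuelingBandit.duelingKernel (DuelingBandit.kern H) p q)
    (B lam δ : ℝ) (hlam : 0 < lam) (hδ0 : 0 < δ) (hδ1 : δ ≤ 1)
    (f : H) (hf : ‖f‖ ≤ B) (xstar : X) (hstar : ∀ x : X, f x ≤ f xstar)
    {Ω : Type*} {mΩ : MeasurableSpace Ω} (μ : Measure Ω) [IsProbabilityMeasure μ]
    (ℱ : Filtration ℕ mΩ) (z : ℕ → Ω → X × X) (y : ℕ → Ω → ℝ)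
    (hint : DuelingBandit.IsPreferenceInteraction μ ℱ (fun x : X => f x) z y)
    (hhat h : ℕ → Ω → HD)
    (hmin : ∀ᵐ ω ∂μ, ∀ t, DuelingBandit.IsLogisticMinimizer lam
      (DuelingBandit.past z t ω) (DuelingBandit.past y t ω) (hhat t ω))
    (hproj : ∀ᵐ ω ∂μ, ∀ t, DuelingBandit.IsProjection lam (lam * DuelingBandit.kappa (2 * B)) B
      (DuelingBandit.past z t ω) (hhat t ω) (h t ω))
    (hplay : ∀ᵐ ω ∂μ, ∀ t, DuelingBandit.IsMaxInPChoice (fun p : X × X => h t ω p)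
      (DuelingBandit.sigma (DuelingBandit.duelingKernel (DuelingBandit.kern H))
        (lam * DuelingBandit.kappa (2 * B)) (DuelingBandit.past z t ω))
      (DuelingBandit.beta (DuelingBandit.duelingKernel (DuelingBandit.kern H))
        lam B (2 * B) δ t)
      (z t ω)) :
    ENNReal.ofReal (1 - δ) ≤ μ {ω | ∀ T : ℕ,
      DuelingBandit.duelingRegret (fun x : X => f x) xstar z T ω
          ≤ 3 * √2 / √(Real.log (1 + 4 * (lam * DuelingBandit.kappa (2 * B))⁻¹))
            * DuelingBandit.beta (DuelingBandit.duelingKernel (DuelingBandit.kern H))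
              lam B (2 * B) δ T
            * √(T * DuelingBandit.infoGain (DuelingBandit.duelingKernel (DuelingBandit.kern H))
              (lam * DuelingBandit.kappa (2 * B)) T) ∧
      ((∀ t < T, ‖hhat t ω‖ ≤ B) →
        DuelingBandit.duelingRegret (fun x : X => f x) xstar z T ω
          ≤ 4 / √(Real.log (1 + 4 * (lam * DuelingBandit.kappa (2 * B))⁻¹))
            * DuelingBandit.beta (DuelingBandit.duelingKernel (DuelingBandit.kern H))
              lam B (2 * B) δ T
            * √(T * DuelingBandit.infoGain (DuelingBandit.duelingKernel (DuelingBandit.kern H))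
              (lam * DuelingBandit.kappa (2 * B)) T))} := by
  have hker : DuelingBandit.duelingKernel (DuelingBandit.kern H) = DuelingBandit.kern HD :=
    funext fun p => funext fun q => (hHD p q).symm
  have hk4 : ∀ p : X × X, DuelingBandit.kern HD p p ≤ 4 := fun p => by
    rw [hHD]; exact DuelingBandit.duelingKernel_self_le hk p
  have hR : ∀ p : X × X, ‖DuelingBandit.feature HD p‖ ≤ 2 := fun p => by
    refine abs_le_of_sq_le_sq' ?_ zero_le_two |>.2
    rw [DuelingBandit.norm_feature_sq]
    linarith [hk4 p]
  have hkD : Measurable fun p : (X × X) × (X × X) => DuelingBandit.kern HD p.1 p.2 := by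
    rw [← hker]
    exact DuelingBandit.measurable_duelingKernel hkmeas
  have hne : Nonempty (X × X) := ⟨(xstar, xstar)⟩
  have hB : 0 ≤ B := (norm_nonneg f).trans hf
  have hκ : 0 < DuelingBandit.kappa (2 * B) := DuelingBandit.kappa_pos (by positivity)
  have hc : 0 < lam * DuelingBandit.kappa (2 * B) := by positivity
  obtain ⟨g, hgf, hg⟩ := DuelingBandit.exists_dueling_utility hHD f
  have hgB : ‖g‖ ≤ B := hgf.trans hf
  obtain ⟨y', hy'm, hy'01, hy'y⟩ :=
    DuelingBandit.exists_binary_modification hint.measurable_feedback hint.binary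
  have hcond : ∀ t, μ[y' t | ℱ t] =ᵐ[μ] fun ω => Real.sigmoid (g (z t ω)) := fun t => by
    refine ((condExp_congr_ae (hy'y t)).trans (hint.condProb t)).trans ?_
    exact Filter.Eventually.of_forall fun ω => by
      simp only [DuelingBandit.prefProb, hg]
  obtain ⟨hbadm, hbad⟩ := DuelingBandit.measure_exists_le_potential hc hkD hR g
    hint.measurable_action hy'm hy'01 hcond (inv_pos.2 hδ0)
  rw [inv_inv] at hbad
  rw [hker] at hplay ⊢
  set bad : Set Ω := {ω | ∃ t, δ⁻¹ ≤ DuelingBandit.potential (lam * DuelingBandit.kappa (2 * B)) g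
    (DuelingBandit.past z t ω) (DuelingBandit.past y' t ω)} with hbad_def
  have hgood : ENNReal.ofReal (1 - δ) ≤ μ badᶜ := by
    rw [prob_compl_eq_one_sub hbadm, ENNReal.ofReal_sub _ hδ0.le, ENNReal.ofReal_one]
    exact tsub_le_tsub_left hbad 1
  -- An almost sure inclusion suffices: the target event need not be measurable, and the null sets
  -- of the hypotheses and of the modification y' are discarded here.
  refine hgood.trans (measure_mono_ae ?_)
  filter_upwards [hmin, hproj, hplay, ae_all_iff.2 hy'y] with ω hmin hproj hplay hyy hω
  have hpast : ∀ t, DuelingBandit.past y' t ω = DuelingBandit.past y t ω := fun t =>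
    funext fun i => hyy i
  have hnoise : ∀ t, 2 * DuelingBandit.invCovNorm (lam * DuelingBandit.kappa (2 * B))
      (DuelingBandit.past z t ω) (DuelingBandit.noiseSum g (DuelingBandit.past z t ω)
        (DuelingBandit.past y t ω)) ^ 2
      ≤ DuelingBandit.infoGain (DuelingBandit.kern HD) (lam * DuelingBandit.kappa (2 * B)) t
        + Real.log (1 / δ) := fun t => by
    refine DuelingBandit.noise_le_of_potential_lt hc hk4 hδ0 ?_
    rw [← hpast]
    exact not_le.1 fun h => hω ⟨t, h⟩
  -- The factor m is the loss due to projection. The condition m ≤ 4 ensures that the proved width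
  -- (m/4)β does not exceed the β used by the algorithm.
  have hround : ∀ (m : ℝ) (t : ℕ), 0 ≤ m → m ≤ 4 →
      DuelingBandit.invCovNorm (lam * DuelingBandit.kappa (2 * B)) (DuelingBandit.past z t ω)
        (DuelingBandit.gradMap lam (DuelingBandit.past z t ω) (h t ω)
          - DuelingBandit.gradMap lam (DuelingBandit.past z t ω) g)
      ≤ m * DuelingBandit.invCovNorm (lam * DuelingBandit.kappa (2 * B))
        (DuelingBandit.past z t ω)
        (DuelingBandit.gradMap lam (DuelingBandit.past z t ω) (hhat t ω)
          - DuelingBandit.gradMap lam (DuelingBandit.past z t ω) g) →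
      (DuelingBandit.prefProb (fun x : X => f x) xstar (z t ω).1
        + DuelingBandit.prefProb (fun x : X => f x) xstar (z t ω).2 - 1) / 2
      ≤ (DuelingBandit.beta (DuelingBandit.kern HD) lam B (2 * B) δ t
          + m / 4 * DuelingBandit.beta (DuelingBandit.kern HD) lam B (2 * B) δ t)
        * DuelingBandit.sigma (DuelingBandit.kern HD) (lam * DuelingBandit.kappa (2 * B))
          (DuelingBandit.past z t ω) (z t ω) := by
    intro m t hm0 hm4 hgrad
    have hβ := DuelingBandit.beta_nonneg (lam := lam) (δ := δ) hB (by positivity : 0 ≤ 2 * B)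
      (DuelingBandit.kern HD) t
    refine DuelingBandit.round_regret_le (g := g) hstar hg ?_ (by positivity) ?_ ?_ (hplay t)
    · exact fun p => Real.sqrt_nonneg _
    · nlinarith
    · exact DuelingBandit.abs_sigmoid_sub_le_beta hB hlam hk4 hm0 (hproj t).1 hgB (hmin t) hgrad
        (hnoise t)
  intro T
  refine ⟨?_, fun hle => ?_⟩
  · exact DuelingBandit.sum_regret_le hB hlam hk4 zero_le_two DuelingBandit.regret_constants.1
      (fun t => z t ω) _ T fun t _ => hround 2 t (by norm_num) (by norm_num)
        (DuelingBandit.invCovNorm_gradMap_proj_sub_le hc (hproj t) hgB)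
  · exact DuelingBandit.sum_regret_le hB hlam hk4 zero_le_one DuelingBandit.regret_constants.2
      (fun t => z t ω) _ T fun t ht => hround 1 t (by norm_num) (by norm_num)
        (DuelingBandit.invCovNorm_gradMap_proj_sub_le_of_norm_le hc (hproj t) (hle t ht))
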